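/- Let $Q$ be a finitely generated commutative monoid (written additively), $k$ a field, and $I\subseteq k[Q]$ a binomial ideal, i.e. an ideal generated by elements $t^p-\lambda t^q$ with $p,q\in Q$ and $\lambda\in k$ (possibly $\lambda=0$). Conventions. For any ideal $J\subseteq k[Q]$ write $p\sim_J q$ if $t^p-\lambda t^q\in J$ for some $\lambda\in k^*$; this is a congruence on $Q$. A nil of a monoid is an absorbing element; the one-element monoid, being a group, is considered to have no nil. An element is nilpotent if one of its multiples is nil, cancellative if adding it is injective, and partly cancellative if $x+a=x+b$ not nil implies $a=b$ for cancellative $a,b$. Green's preorder is $x\preceq y\iff y\in x+M$. A prime $P\subset Q$ is a proper, possibly empty, prime ideal of $Q$; $Q_P$ is the localization inverting $Q\setminus P$, $G_P$ is its unit group, $k[Q]_P=k[Q_P]$, $J_P=J\,k[Q]_P$, $\mathfrak m_P=\langle t^p\mid p\in P\rangle\subseteq k[Q]_P$, and for a congruence $\sim$ on $Q$, $\overline Q_P$ is the quotient of $Q_P$ by the congruence induced by $\sim$. A congruence is mesoprimary if every element of $\overline Q=Q/{\sim}$ is nilpotent or cancellative and every element is partly cancellative; it is $P$-mesoprimary if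 moreover $P$ is the set of elements of $Q$ with nilpotent image. It is coprincipal if it is $P$-mesoprimary for some $P$ and the set of non-nil elements of $\overline Q_P$ that are taken to nil by every nonunit is exactly one class of Green's relation. A binomial ideal is mesoprimary, $P$-mesoprimary or coprincipal if it is maximal among the proper binomial ideals inducing its congruence and that congruence is mesoprimary, $P$-mesoprimary or coprincipal, respectively. Now take $\sim\,=\,\sim_I$. An element $w\in Q$ is an $I$-witness for $P$ if $t^w\notin I_P$, the image $\overline w\in\overline Q_P$ is not nil, and for every $p\in P$ there is $b\in\overline Q_P$ with $b\neq\overline w$ and $\overline p+b=\overline p+\overline w$. (For $P=\varnothing$ this says that $I$ contains no monomial.) The $P$-mesoprime of $I$ at $w$ is the preimage in $k[Q]$ of $(I_P:t^w)+\mathfrak m_P$. Let $K_w\subseteq G_P$ be the stabilizer of $\overline w$. The character of $I_P$ at $w$ is the homomorphism $\rho:K_w\to k^*$ with $I_\rho+\mathfrak m_P=(I_P:t^w)+\mathfrak m_P$, where $I_\rho=\langle t^u-\rho(u-v)t^v\mid u-v\in K_w\rangle\subseteq k[Q]_P$, if there is one. For an $I$-witness $w$ for $P$ that has a character $\rho$,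 the coprincipal component $W_w^P(I)$ of $I$ cogenerated by $w$ at $P$ is the preimage in $k[Q]$ of $I_P+I_\rho+M\,k[Q]_P$, where $M\subseteq k[Q]$ is generated by the monomials $t^u$ with $\overline u\not\preceq\overline w$ in $\overline Q_P$. Theorem. (1) If $w$ is an $I$-witness for $P$ and $\overline p+\overline w\not\preceq\overline w$ in $\overline Q_P$ for all $p\in P$, then there is exactly one character of $I_P$ at $w$. (2) Every coprincipal component $W_w^P(I)$ cogenerated by an $I$-witness $w$ for a prime $P$ is a coprincipal, $P$-mesoprimary binomial ideal. (3) $I$ is the intersection of the coprincipal components $W_w^P(I)$ cogenerated by its witnesses, over all primes $P$ and all $I$-witnesses $w$ for $P$ that have a character. (4) Consequently $I$ has a combinatorial mesoprimary decomposition: $I$ is the intersection of a finite set of mesoprimary ideals $J$, which can be chosen among the components in (3), such that whenever $J$ is $P$-mesoprimary and $t^q$ is a monomial in the $P$-socle modulo $J$ (that is, $t^q\notin J_P$ and $\mathfrak m_P t^q\subseteq J_P$), the element $q$ is an $I$-witness for $P$ and the $P$-mesoprimes of $I$ and of $J$ at $q$ coincide. -/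

import Mathlib

namespace BinomialDecomposition

/-! ### Commutative monoids, written additively -/

section Monoid

variable {M : Type*} [AddCommMonoid M]

/-- A nil is an absorbing element. By convention the one-element monoid, being a group, has no nil;
in every other monoid this is the usual notion. -/
def IsNil (x : M) : Prop := (∃ y : M, y ≠ x) ∧ ∀ y : M, y + x = x

/-- Some multiple is nil. -/
def IsNilpotentElt (x : M) : Prop := ∃ n : ℕ, IsNil (n • x)

/-- Addition of `x` is injective. -/
def IsCancellative (x : M) : Prop := ∀ a b : M, x + a = x + b → a = b

/-- `x + a = x + b`, not nil, forces `a = b` for cancellative `a`, `b`. -/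
def IsPartlyCancellative (x : M) : Prop :=
  ∀ a b : M, IsCancellative a → IsCancellative b → x + a = x + b → ¬ IsNil (x + a) → a = b

/-- Green's preorder (divisibility): the ideal of `x` contains the ideal of `y`. -/
def GreenLE (x y : M) : Prop := ∃ u : M, x + u = y

/-- The socle: the non-nil elements that every nonunit takes to nil. -/
def socle (M : Type*) [AddCommMonoid M] : Set M :=
  {s | ¬ IsNil s ∧ ∀ a : M, ¬ IsAddUnit a → IsNil (s + a)}

/-- A (proper) prime ideal of a commutative monoid; it may be empty. -/
structure MonoidPrime (Q : Type*) [AddCommMonoid Q] where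
  /-- The underlying set. -/
  carrier : Set Q
  zero_notMem : (0 : Q) ∉ carrier
  add_mem : ∀ p ∈ carrier, ∀ q : Q, p + q ∈ carrier
  mem_or_mem : ∀ a b : Q, a + b ∈ carrier → a ∈ carrier ∨ b ∈ carrier

variable {Q : Type*} [AddCommMonoid Q]

/-- The complement of a prime ideal, a submonoid. -/
def MonoidPrime.face (P : MonoidPrime Q) : AddSubmonoid Q where
  carrier := P.carrierᶜ
  zero_mem' := P.zero_notMem
  add_mem' := fun ha hb h => (P.mem_or_mem _ _ h).elim ha hb

/-- The localization `Q_P`. -/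
abbrev MonoidPrime.Loc (P : MonoidPrime Q) : Type _ := AddLocalization P.face

/-- The canonical homomorphism `Q → Q_P`. -/
def MonoidPrime.toLoc (P : MonoidPrime Q) : Q →+ P.Loc :=
  (AddLocalization.addMonoidOf P.face).toAddMonoidHom

/-- The congruence on `Q_P` induced by (that is, generated by the image of) a congruence on `Q`. -/
def locCon (c : AddCon Q) (P : MonoidPrime Q) : AddCon P.Loc :=
  c.mapGen P.toLoc

/-- The localized quotient `Q_P / c`. -/
abbrev LocQuot (c : AddCon Q) (P : MonoidPrime Q) : Type _ := (locCon c P).Quotient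

/-- The map from `Q` to the localized quotient. -/
def toLocQuot (c : AddCon Q) (P : MonoidPrime Q) : Q →+ LocQuot c P :=
  (locCon c P).mk'.comp P.toLoc

/-- A congruence is mesoprimary if every element of the quotient is nilpotent or cancellative, and
every element is partly cancellative. -/
def IsMesoprimaryCon (c : AddCon Q) : Prop :=
  (∀ x : c.Quotient, IsNilpotentElt x ∨ IsCancellative x) ∧
    ∀ x : c.Quotient, IsPartlyCancellative x

/-- The elements whose class is nilpotent. -/
def nilpotentIdeal (c : AddCon Q) : Set Q := {q | IsNilpotentElt (q : c.Quotient)}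

/-- `c` is `P`-mesoprimary: mesoprimary, with `P` as nilpotent ideal (its associated prime). -/
def IsMesoprimaryConFor (c : AddCon Q) (P : MonoidPrime Q) : Prop :=
  IsMesoprimaryCon c ∧ P.carrier = nilpotentIdeal c

/-- A congruence is coprincipal if it is `P`-mesoprimary for some prime `P` and the socle of the
localized quotient at `P` consists of exactly one class of Green's relation. -/
def IsCoprincipalCon (c : AddCon Q) : Prop :=
  ∃ P : MonoidPrime Q, IsMesoprimaryConFor c P ∧ (socle (LocQuot c P)).Nonempty ∧
    ∀ s ∈ socle (LocQuot c P), ∀ s' ∈ socle (LocQuot c P), GreenLE s s' ∧ GreenLE s' s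

/-- The order ideal of `Q` cogenerated by `w` at `P`: the elements whose image in the localized
quotient precedes that of `w` in Green's preorder. -/
def orderIdeal (c : AddCon Q) (P : MonoidPrime Q) (w : Q) : Set Q :=
  {a | GreenLE (toLocQuot c P a) (toLocQuot c P w)}

end Monoid

/-! ### Binomial ideals in monoid algebras -/

section Algebra

variable {k : Type*} [Field k] {Q : Type*} [AddCommMonoid Q]

/-- The monomial `t ^ q`. -/
noncomputable def mono (k : Type*) [Field k] {Q : Type*} [AddCommMonoid Q] (q : Q) :
    AddMonoidAlgebra k Q :=
  AddMonoidAlgebra.single q 1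

/-- An ideal generated by binomials `t ^ p - c t ^ q`; the scalar `c` may be zero. -/
def IsBinomial (I : Ideal (AddMonoidAlgebra k Q)) : Prop :=
  ∃ S : Set (AddMonoidAlgebra k Q),
    (∀ f ∈ S, ∃ (p q : Q) (c : k), f = mono k p - c • mono k q) ∧ I = Ideal.span S

/-- The congruence induced by an ideal: `p ~ q` if `t ^ p - c t ^ q` lies in `I` for some unit
`c` of `k`. -/
def inducedCon (I : Ideal (AddMonoidAlgebra k Q)) : AddCon Q where
  r p q := ∃ c : kˣ, mono k p - (c : k) • mono k q ∈ I
  iseqv :=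
    { refl := fun p => ⟨1, by simp⟩
      symm := by
        rintro p q ⟨c, hc⟩
        refine ⟨c⁻¹, ?_⟩
        have h := Submodule.smul_of_tower_mem I (-((c⁻¹ : kˣ) : k)) hc
        have e : (-((c⁻¹ : kˣ) : k)) • (mono k p - (c : k) • mono k q)
            = mono k q - ((c⁻¹ : kˣ) : k) • mono k p := by
          rw [smul_sub, smul_smul, neg_mul, Units.inv_mul, neg_smul, neg_smul, one_smul]
          abel
        rwa [e] at h
      trans := by
        rintro p q r ⟨c, hc⟩ ⟨d, hd⟩
        refine ⟨c * d, ?_⟩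
        have h := I.add_mem hc (Submodule.smul_of_tower_mem I (c : k) hd)
        have e : mono k p - (c : k) • mono k q + (c : k) • (mono k q - (d : k) • mono k r)
            = mono k p - ((c * d : kˣ) : k) • mono k r := by
          rw [smul_sub, smul_smul, Units.val_mul]
          abel
        rwa [e] at h }
  add' := by
    rintro p q r s ⟨c, hc⟩ ⟨d, hd⟩
    refine ⟨c * d, ?_⟩
    have h := I.add_mem (I.mul_mem_left (mono k r) hc) (I.mul_mem_left ((c : k) • mono k q) hd)
    have e : mono k r * (mono k p - (c : k) • mono k q)
        + (c : k) • mono k q * (mono k r - (d : k) • mono k s)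
        = mono k (p + r) - ((c * d : kˣ) : k) • mono k (q + s) := by
      have m : ∀ a b : Q, mono k (a + b) = mono k a * mono k b := by
        intro a b
        simp [mono, AddMonoidAlgebra.single_mul_single]
      rw [m p r, m q s, Units.val_mul]
      simp only [Algebra.smul_def, map_mul]
      ring
    rwa [e] at h

/-- `I` is maximal among the proper binomial ideals that induce the same congruence as `I`. -/
def IsMaximalForCon (I : Ideal (AddMonoidAlgebra k Q)) : Prop :=
  Maximal (fun J : Ideal (AddMonoidAlgebra k Q) =>
    IsBinomial J ∧ J ≠ ⊤ ∧ inducedCon J = inducedCon I) I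

/-- A mesoprimary binomial ideal: maximal among the proper binomial ideals inducing a given
mesoprimary congruence. -/
def IsMesoprimary (I : Ideal (AddMonoidAlgebra k Q)) : Prop :=
  IsMaximalForCon I ∧ IsMesoprimaryCon (inducedCon I)

/-- A `P`-mesoprimary binomial ideal. -/
def IsMesoprimaryFor (I : Ideal (AddMonoidAlgebra k Q)) (P : MonoidPrime Q) : Prop :=
  IsMaximalForCon I ∧ IsMesoprimaryConFor (inducedCon I) P

/-- A coprincipal binomial ideal: maximal among the proper binomial ideals inducing a given
coprincipal congruence. -/
def IsCoprincipal (I : Ideal (AddMonoidAlgebra k Q)) : Prop :=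
  IsMaximalForCon I ∧ IsCoprincipalCon (inducedCon I)

/-- The map from `k[Q]` to its monomial localization `k[Q]_P = k[Q_P]`. -/
noncomputable def locMap (k : Type*) [Field k] {Q : Type*} [AddCommMonoid Q]
    (P : MonoidPrime Q) : AddMonoidAlgebra k Q →+* AddMonoidAlgebra k P.Loc :=
  AddMonoidAlgebra.mapDomainRingHom k P.toLoc

/-- The localization `I_P` of an ideal, an ideal of `k[Q_P]`. -/
noncomputable def locIdeal (I : Ideal (AddMonoidAlgebra k Q)) (P : MonoidPrime Q) :
    Ideal (AddMonoidAlgebra k P.Loc) :=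
  I.map (locMap k P)

/-- The monomial ideal `m_P` of `k[Q_P]`, generated by the `t ^ p` with `p ∈ P`. -/
noncomputable def primeMonomialIdeal (k : Type*) [Field k] {Q : Type*} [AddCommMonoid Q]
    (P : MonoidPrime Q) : Ideal (AddMonoidAlgebra k P.Loc) :=
  Ideal.span ((fun p : Q => mono k (P.toLoc p)) '' P.carrier)

/-- `w` is an `I`-witness for `P`: its image in the localized quotient is not nil, and for each
`p ∈ P` it is joined to some other element by the addition of `p`. For `P ≠ ∅` the first condition
follows from the other two; for `P = ∅` the definition says that `I` contains no monomial. -/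
def IsWitness (I : Ideal (AddMonoidAlgebra k Q)) (P : MonoidPrime Q) (w : Q) : Prop :=
  mono k (P.toLoc w) ∉ locIdeal I P ∧
  ¬ IsNil (toLocQuot (inducedCon I) P w) ∧
  ∀ p ∈ P.carrier, ∃ b : LocQuot (inducedCon I) P,
    b ≠ toLocQuot (inducedCon I) P w ∧
      toLocQuot (inducedCon I) P p + b
        = toLocQuot (inducedCon I) P p + toLocQuot (inducedCon I) P w

/-- The stabilizer of the class of `w` in the unit group `G_P` of `Q_P`. -/
def stabilizer (I : Ideal (AddMonoidAlgebra k Q)) (P : MonoidPrime Q) (w : Q) :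
    AddSubgroup (AddUnits P.Loc) where
  carrier := {g | (locCon (inducedCon I) P) ((g : P.Loc) + P.toLoc w) (P.toLoc w)}
  zero_mem' := by
    simpa using (locCon (inducedCon I) P).refl (P.toLoc w)
  add_mem' := by
    intro g h hg hh
    have h1 := (locCon (inducedCon I) P).add ((locCon (inducedCon I) P).refl (g : P.Loc)) hh
    have h2 := (locCon (inducedCon I) P).trans h1 hg
    simpa [add_assoc] using h2
  neg_mem' := by
    intro g hg
    have h1 := (locCon (inducedCon I) P).add
      ((locCon (inducedCon I) P).refl ((-g : AddUnits P.Loc) : P.Loc)) hg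
    rw [← add_assoc, AddUnits.neg_add, zero_add] at h1
    exact (locCon (inducedCon I) P).symm h1

/-- The ideal of `k[Q_P]` of a character `ρ : K → k*` on a subgroup `K` of `G_P`, generated by the
binomials `t ^ u - ρ (u - v) t ^ v` with `u - v ∈ K`. -/
noncomputable def characterIdeal {P : MonoidPrime Q} {K : AddSubgroup (AddUnits P.Loc)}
    (ρ : Multiplicative K →* kˣ) : Ideal (AddMonoidAlgebra k P.Loc) :=
  Ideal.span {f | ∃ (g : K) (v : P.Loc),
    f = mono k (((g : AddUnits P.Loc) : P.Loc) + v)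
      - ((ρ (Multiplicative.ofAdd g) : kˣ) : k) • mono k v}

/-- The ideal `(I_P : t ^ q) + m_P` of `k[Q_P]`. -/
noncomputable def localMesoprimeAt (I : Ideal (AddMonoidAlgebra k Q)) (P : MonoidPrime Q) (q : Q) :
    Ideal (AddMonoidAlgebra k P.Loc) :=
  (locIdeal I P).colon {mono k (P.toLoc q)} ⊔ primeMonomialIdeal k P

/-- The `P`-mesoprime of `I` at `q`: the preimage in `k[Q]` of `(I_P : t ^ q) + m_P`. -/
noncomputable def mesoprimeAt (I : Ideal (AddMonoidAlgebra k Q)) (P : MonoidPrime Q) (q : Q) :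
    Ideal (AddMonoidAlgebra k Q) :=
  (localMesoprimeAt I P q).comap (locMap k P)

/-- `ρ` is the character of `I_P` at `w`: its domain is the stabilizer of `w`, and
`I_ρ + m_P = (I_P : t ^ w) + m_P`. -/
def IsCharacterAt (I : Ideal (AddMonoidAlgebra k Q)) (P : MonoidPrime Q) (w : Q)
    (ρ : Multiplicative (stabilizer I P w) →* kˣ) : Prop :=
  characterIdeal ρ ⊔ primeMonomialIdeal k P = localMesoprimeAt I P w

/-- The monomial ideal of `k[Q]` cogenerated by `w` along `P`, generated by the monomials outside
of the order ideal cogenerated by `w` at `P`. -/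
noncomputable def cogeneratedMonomialIdeal (I : Ideal (AddMonoidAlgebra k Q)) (P : MonoidPrime Q)
    (w : Q) : Ideal (AddMonoidAlgebra k Q) :=
  Ideal.span ((fun u : Q => mono k u) '' (orderIdeal (inducedCon I) P w)ᶜ)

/-- The component of `I` cogenerated by `w` along `P`, for the character `ρ` of `I_P` at `w`: the
preimage in `k[Q]` of the sum of `I_P`, the ideal of `ρ`, and the monomial ideal cogenerated
by `w`. -/
noncomputable def component (I : Ideal (AddMonoidAlgebra k Q)) (P : MonoidPrime Q) (w : Q)
    (ρ : Multiplicative (stabilizer I P w) →* kˣ) : Ideal (AddMonoidAlgebra k Q) :=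
  (locIdeal I P ⊔ characterIdeal ρ ⊔ (cogeneratedMonomialIdeal I P w).map (locMap k P)).comap
    (locMap k P)

/-- `J` is the coprincipal component of `I` cogenerated at `P` by some `I`-witness for `P`. -/
def IsCoprincipalComponent (I : Ideal (AddMonoidAlgebra k Q)) (P : MonoidPrime Q)
    (J : Ideal (AddMonoidAlgebra k Q)) : Prop :=
  ∃ (w : Q) (ρ : Multiplicative (stabilizer I P w) →* kˣ),
    IsWitness I P w ∧ IsCharacterAt I P w ρ ∧ J = component I P w ρ

/-- The monomial `t ^ q` lies in the `P`-socle modulo `J`: it is nonzero in `k[Q]_P / J_P` and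
annihilated there by `m_P`. -/
def InMonomialSocle (J : Ideal (AddMonoidAlgebra k Q)) (P : MonoidPrime Q) (q : Q) : Prop :=
  mono k (P.toLoc q) ∉ locIdeal J P ∧ ∀ p ∈ P.carrier, mono k (P.toLoc (p + q)) ∈ locIdeal J P

/-- A mesoprimary decomposition of `I`: finitely many mesoprimary ideals with intersection `I`
such that, for each `P`-mesoprimary `J` among them, the `P`-mesoprimes of `I` and `J` agree at every
socle monomial of `J` along `P`. -/
def IsMesoprimaryDecomposition (I : Ideal (AddMonoidAlgebra k Q))
    (𝒥 : Set (Ideal (AddMonoidAlgebra k Q))) : Prop :=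
  𝒥.Finite ∧ I = sInf 𝒥 ∧ (∀ J ∈ 𝒥, IsMesoprimary J) ∧
    ∀ J ∈ 𝒥, ∀ P : MonoidPrime Q, IsMesoprimaryFor J P → ∀ q : Q, InMonomialSocle J P q →
      mesoprimeAt I P q = mesoprimeAt J P q

/-- A mesoprimary decomposition is combinatorial if the socle monomials of every component are
`I`-witnesses. -/
def IsCombinatorialDecomposition (I : Ideal (AddMonoidAlgebra k Q))
    (𝒥 : Set (Ideal (AddMonoidAlgebra k Q))) : Prop :=
  IsMesoprimaryDecomposition I 𝒥 ∧
    ∀ J ∈ 𝒥, ∀ P : MonoidPrime Q, IsMesoprimaryFor J P → ∀ q : Q, InMonomialSocle J P q →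
      IsWitness I P q

end Algebra

end BinomialDecomposition

/-! Modulo a binomial ideal `J`, two monomials are proportional or independent: for each monomial
outside `J` there is a functional that kills `J`, is nonzero on that monomial and vanishes on all
other classes (`IsBinomial.exists_functional`). Conversely, an element killed by enough such
functionals lies in the ideal generated by the binomials of `J` (`mem_binomialPart_of_functionals`).
Nearly every membership below is decided by these two facts.

If no nonunit of `Q_P` maps `w` to an element preceding `w`, then `t^{g+w} ≡ ρ(g) t^w` defines `ρ`
on the stabilizer, and `(I_P : t^w)` modulo `m_P` is `I_ρ`. Conversely, a character forces this
condition, since otherwise `1 ∈ I_ρ + m_P` (`IsCharacterAt.not_locLE`). So in the component at `w`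
every nonunit translate of `w` vanishes, while `t^w` survives, because the functional of `I_P` at
`w` also kills what is added. The monomials that survive are those preceding `w`, joined only along
the stabilizer (`inducedCon_locComponent`). From this description follow maximality, the mesoprimary
property and the socle.

For the intersection, let `f ∉ I`. A monomial multiple of `f` with maximal annihilator yields a
prime `P` at which this multiple is nonzero and killed by `m_P` (`exists_prime_socle`). Write it
modulo `I_P` with terms from distinct nonzero classes and take a term `w` minimal in Green's
preorder. Each nonunit must cancel this term against another one or kill it, so `w` is a witness;
minimality gives it a character, and its component excludes the element (`exists_component_notMem`).

Finiteness: there are finitely many primes, each socle is finitely generated, and `w` may be taken,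
up to units, among the terms of the generators; unit translation does not change the component.
Finally, the socle monomials of a component are unit translates of `w` modulo `I_P`, so they inherit
the witness property and the mesoprime. -/

namespace BinomialDecomposition

/-! ### Binomial ideals: classes of monomials, functionals, normal forms -/

section MonoidAlgebra

variable {k : Type*} [Field k] {S : Type*} [AddCommMonoid S]

theorem mono_add (a b : S) : mono k (a + b) = mono k a * mono k b := by
  simp [mono, AddMonoidAlgebra.single_mul_single]

theorem mono_zero : mono k (0 : S) = 1 := rfl

theorem single_eq_smul_mono (u : S) (r : k) : AddMonoidAlgebra.single u r = r • mono k u := by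
  simp [mono, AddMonoidAlgebra.smul_single]

theorem coeff_mono_self (u : S) : (mono k u).coeff u = 1 := by
  simp [mono]

theorem coeff_mono_of_ne {u v : S} (h : u ≠ v) : (mono k u).coeff v = 0 := by
  simp [mono, AddMonoidAlgebra.coeff_single, Finsupp.single_eq_of_ne h.symm]

theorem eq_sum_smul_mono (f : AddMonoidAlgebra k S) :
    f = ∑ u ∈ f.coeff.support, f.coeff u • mono k u := by
  conv_lhs => rw [← AddMonoidAlgebra.sum_coeff_single f]
  simp only [Finsupp.sum, single_eq_smul_mono]

theorem mono_induction {p : AddMonoidAlgebra k S → Prop} (f : AddMonoidAlgebra k S) (zero : p 0)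
    (add : ∀ f g, p f → p g → p (f + g)) (smul : ∀ (r : k) (u : S), p (r • mono k u)) : p f := by
  induction f using AddMonoidAlgebra.induction_linear with
  | zero => exact zero
  | add f g hf hg => exact add f g hf hg
  | single u r => rw [single_eq_smul_mono]; exact smul r u

/-- The linear map on the monoid algebra with prescribed values on monomials. -/
noncomputable def linearExtension {E : Type*} [AddCommGroup E] [Module k E] (χ : S → E) :
    AddMonoidAlgebra k S →ₗ[k] E :=
  (Finsupp.linearCombination k χ) ∘ₗ
    ({ toFun := AddMonoidAlgebra.coeff
       map_add' := fun _ _ => rfl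
       map_smul' := fun _ _ => rfl } : AddMonoidAlgebra k S →ₗ[k] S →₀ k)

theorem linearExtension_mono {E : Type*} [AddCommGroup E] [Module k E] (χ : S → E) (u : S) :
    linearExtension (k := k) χ (mono k u) = χ u := by
  change Finsupp.linearCombination k χ (Finsupp.single u 1) = χ u
  simp

theorem map_eq_of_forall_ne {E : Type*} [AddCommGroup E] [Module k E]
    (φ : AddMonoidAlgebra k S →ₗ[k] E) (f : AddMonoidAlgebra k S) (u : S)
    (h : ∀ v ∈ f.coeff.support, v ≠ u → φ (mono k v) = 0) :
    φ f = f.coeff u • φ (mono k u) := by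
  conv_lhs => rw [eq_sum_smul_mono f, map_sum]
  rw [Finset.sum_eq_single u]
  · rw [map_smul]
  · intro v hv hne
    rw [map_smul, h v hv hne, smul_zero]
  · intro hu
    rw [Finsupp.notMem_support_iff.1 hu, zero_smul, map_zero]

theorem map_eq_zero_of_forall {E : Type*} [AddCommGroup E] [Module k E]
    (φ : AddMonoidAlgebra k S →ₗ[k] E) (f : AddMonoidAlgebra k S)
    (h : ∀ v ∈ f.coeff.support, φ (mono k v) = 0) : φ f = 0 := by
  rw [eq_sum_smul_mono f, map_sum]
  exact Finset.sum_eq_zero fun v hv => by rw [map_smul, h v hv, smul_zero]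

theorem smul_mem_ideal {J : Ideal (AddMonoidAlgebra k S)} (r : k) {f : AddMonoidAlgebra k S}
    (h : f ∈ J) : r • f ∈ J :=
  Submodule.smul_of_tower_mem J r h

theorem smul_mem_ideal_iff {J : Ideal (AddMonoidAlgebra k S)} {r : k} (hr : r ≠ 0)
    {f : AddMonoidAlgebra k S} : r • f ∈ J ↔ f ∈ J := by
  refine ⟨fun h => ?_, smul_mem_ideal r⟩
  have := smul_mem_ideal r⁻¹ h
  rwa [smul_smul, inv_mul_cancel₀ hr, one_smul] at this

/-- As a vector space the ideal is spanned by the monomial multiples of `T`. Hence the test applies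
to subspaces `V` that are not ideals, typically kernels of functionals. -/
theorem mem_of_mem_ideal_span {T : Set (AddMonoidAlgebra k S)}
    (V : Submodule k (AddMonoidAlgebra k S)) (hV : ∀ a : S, ∀ f ∈ T, mono k a * f ∈ V)
    {f : AddMonoidAlgebra k S} (hf : f ∈ Ideal.span T) : f ∈ V := by
  suffices ∀ r : AddMonoidAlgebra k S, r * f ∈ V by simpa using this 1
  induction hf using Submodule.span_induction with
  | mem x hx =>
    intro r
    induction r using mono_induction with
    | zero => simp
    | add r s hr hs => rw [add_mul]; exact V.add_mem hr hs
    | smul c u => rw [smul_mul_assoc]; exact V.smul_mem _ (hV u x hx)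
  | zero => simp
  | add x y _ _ hx hy => intro r; rw [mul_add]; exact V.add_mem (hx r) (hy r)
  | smul a x _ hx => intro r; rw [smul_eq_mul, ← mul_assoc]; exact hx _

theorem mono_mul_binomial (a p q : S) (c : k) :
    mono k a * (mono k p - c • mono k q) = mono k (a + p) - c • mono k (a + q) := by
  rw [mul_sub, mul_smul_comm, mono_add, mono_add]

theorem inducedCon_iff {J : Ideal (AddMonoidAlgebra k S)} {p q : S} :
    inducedCon J p q ↔ ∃ c : kˣ, mono k p - (c : k) • mono k q ∈ J :=
  Iff.rfl

theorem mono_mem_iff_of_sub_mem {J : Ideal (AddMonoidAlgebra k S)} {p q : S} {c : k} (hc : c ≠ 0)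
    (h : mono k p - c • mono k q ∈ J) : mono k p ∈ J ↔ mono k q ∈ J := by
  rw [← smul_mem_ideal_iff (J := J) hc (f := mono k q)]
  constructor
  · intro hp
    have := J.sub_mem hp h
    rwa [sub_sub_cancel] at this
  · intro hq
    have := J.add_mem h hq
    rwa [sub_add_cancel] at this

theorem mono_mem_iff_of_inducedCon {J : Ideal (AddMonoidAlgebra k S)} {p q : S}
    (h : inducedCon J p q) : mono k p ∈ J ↔ mono k q ∈ J := by
  obtain ⟨c, hc⟩ := h
  exact mono_mem_iff_of_sub_mem c.ne_zero hc

theorem inducedCon_of_mono_mem {J : Ideal (AddMonoidAlgebra k S)} {p q : S}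
    (hp : mono k p ∈ J) (hq : mono k q ∈ J) : inducedCon J p q :=
  ⟨1, J.sub_mem hp (smul_mem_ideal _ hq)⟩

theorem mono_add_mem {J : Ideal (AddMonoidAlgebra k S)} {p : S} (hp : mono k p ∈ J) (q : S) :
    mono k (p + q) ∈ J := by
  rw [mono_add]; exact J.mul_mem_right _ hp

theorem mono_mul_mem_iff_of_isAddUnit {J : Ideal (AddMonoidAlgebra k S)} {g : S}
    (hg : IsAddUnit g) {f : AddMonoidAlgebra k S} : mono k g * f ∈ J ↔ f ∈ J := by
  refine ⟨fun h => ?_, J.mul_mem_left _⟩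
  obtain ⟨g, rfl⟩ := hg
  have := J.mul_mem_left (mono k ((-g : AddUnits S) : S)) h
  rwa [← mul_assoc, ← mono_add, AddUnits.neg_add, mono_zero, one_mul] at this

theorem scalar_unique {J : Ideal (AddMonoidAlgebra k S)} {u w : S} (hw : mono k w ∉ J) {c d : k}
    (hc : mono k u - c • mono k w ∈ J) (hd : mono k u - d • mono k w ∈ J) : c = d := by
  by_contra hne
  apply hw
  rw [← smul_mem_ideal_iff (sub_ne_zero.2 hne)]
  have := J.sub_mem hd hc
  rw [sub_sub_sub_cancel_left, ← sub_smul] at this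
  exact this

/-- Modulo a binomial ideal, monomials from different classes are independent: each monomial outside
the ideal is detected by a functional which vanishes on the other classes. -/
theorem IsBinomial.exists_functional {J : Ideal (AddMonoidAlgebra k S)} (hJ : IsBinomial J) {w : S}
    (hw : mono k w ∉ J) : ∃ φ : AddMonoidAlgebra k S →ₗ[k] k,
      (∀ f ∈ J, φ f = 0) ∧ φ (mono k w) = 1 ∧ ∀ u, ¬ inducedCon J u w → φ (mono k u) = 0 := by
  classical
  obtain ⟨T, hT, rfl⟩ := hJ
  set J := Ideal.span T with hJ
  -- The value at `u` is the scalar relating `t^u` to `t^w`, unique because `t^w ∉ J`, and zero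
  -- outside the class of `w`.
  have key : ∀ u : S, ∃ d : k, (∀ c : k, c ≠ 0 → mono k u - c • mono k w ∈ J → d = c) ∧
      (¬ inducedCon J u w → d = 0) := by
    intro u
    by_cases h : inducedCon J u w
    · obtain ⟨c, hc⟩ := h
      exact ⟨c, fun d _ hd => scalar_unique hw hc hd, fun h => (h ⟨c, hc⟩).elim⟩
    · exact ⟨0, fun c hc hm => (h ⟨Units.mk0 c hc, hm⟩).elim, fun _ => rfl⟩
  choose χ hχ hχ0 using key
  refine ⟨linearExtension χ, fun f hf => ?_, ?_, fun u hu => ?_⟩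
  · refine mem_of_mem_ideal_span (LinearMap.ker (linearExtension χ)) ?_ hf
    intro a f hf
    obtain ⟨p, q, c, rfl⟩ := hT f hf
    have hmem : mono k a * (mono k p - c • mono k q) ∈ J :=
      J.mul_mem_left _ (Ideal.subset_span hf)
    rw [mono_mul_binomial] at hmem ⊢
    rw [LinearMap.mem_ker, map_sub, map_smul, linearExtension_mono, linearExtension_mono]
    by_cases hc : c = 0
    · subst hc
      rw [zero_smul, sub_zero] at hmem ⊢
      exact hχ0 _ fun h => hw ((mono_mem_iff_of_inducedCon h).1 hmem)
    · by_cases hq : inducedCon J (a + q) w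
      · obtain ⟨d, hd⟩ := hq
        rw [hχ (a + q) d d.ne_zero hd, hχ (a + p) (c * d) (mul_ne_zero hc d.ne_zero), smul_eq_mul,
          sub_self]
        have := J.add_mem hmem (smul_mem_ideal c hd)
        rwa [smul_sub, smul_smul, sub_add_sub_cancel] at this
      · rw [hχ0 _ hq, smul_zero, sub_zero]
        exact hχ0 _ fun h => hq ((inducedCon J).trans ((inducedCon J).symm
          ⟨Units.mk0 c hc, hmem⟩) h)
  · rw [linearExtension_mono]
    exact hχ w 1 one_ne_zero (by simp)
  · rw [linearExtension_mono, hχ0 u hu]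

/-- An ideal generated by binomials that are homogeneous for a congruence contains both terms of
each of its inhomogeneous binomials. -/
theorem mono_mem_span_of_not_con {T : Set (AddMonoidAlgebra k S)} (c : AddCon S)
    (hT : ∀ f ∈ T, ∃ (p q : S) (r : k), f = mono k p - r • mono k q ∧ (r = 0 ∨ c p q))
    {u v : S} {r : k} (h : mono k u - r • mono k v ∈ Ideal.span T) (huv : ¬ c u v) :
    mono k u ∈ Ideal.span T := by
  classical
  set J := Ideal.span T with hJ
  -- The projection onto the span of the class of `u`. It preserves `J`, since each monomial
  -- multiple of a generator is a scalar-free monomial or lies in a single class.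
  set π : AddMonoidAlgebra k S →ₗ[k] AddMonoidAlgebra k S :=
    linearExtension fun x => if c x u then mono k x else 0 with hπ
  have hπJ : ∀ f ∈ J, π f ∈ J := by
    intro f hf
    refine mem_of_mem_ideal_span ((J.restrictScalars k).comap π) ?_ hf
    intro a f hf
    obtain ⟨p, q, r, rfl, hr⟩ := hT f hf
    have hmem : mono k a * (mono k p - r • mono k q) ∈ J :=
      J.mul_mem_left _ (Ideal.subset_span hf)
    rw [mono_mul_binomial] at hmem ⊢
    rw [Submodule.mem_comap, Submodule.restrictScalars_mem, map_sub, map_smul, hπ,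
      linearExtension_mono, linearExtension_mono]
    rcases hr with rfl | hr
    · rw [zero_smul, sub_zero] at hmem ⊢
      split_ifs
      exacts [hmem, J.zero_mem]
    · have hiff : c (a + p) u ↔ c (a + q) u :=
        ⟨fun h => c.trans (c.symm (c.add (c.refl a) hr)) h,
          fun h => c.trans (c.add (c.refl a) hr) h⟩
      by_cases h : c (a + q) u
      · rw [if_pos h, if_pos (hiff.2 h)]; exact hmem
      · rw [if_neg h, if_neg (h ∘ hiff.1)]; simp
  have := hπJ _ h
  rwa [map_sub, map_smul, hπ, linearExtension_mono, linearExtension_mono, if_pos (c.refl u),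
    if_neg fun h => huv (c.symm h), smul_zero, sub_zero] at this

/-- The ideal generated by the binomials of an ideal. -/
noncomputable def binomialPart (J : Ideal (AddMonoidAlgebra k S)) : Ideal (AddMonoidAlgebra k S) :=
  Ideal.span {f | f ∈ J ∧ ∃ (p q : S) (c : k), f = mono k p - c • mono k q}

theorem binomialPart_le (J : Ideal (AddMonoidAlgebra k S)) : binomialPart J ≤ J :=
  Ideal.span_le.2 fun _ hf => hf.1

theorem isBinomial_of_le_binomialPart {J : Ideal (AddMonoidAlgebra k S)} (h : J ≤ binomialPart J) :
    IsBinomial J :=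
  ⟨_, fun _ hf => hf.2, le_antisymm h (binomialPart_le J)⟩

/-- Every element is congruent, modulo the binomials of `J`, to a combination of monomials outside
of `J` from distinct classes. -/
theorem exists_normalForm (J : Ideal (AddMonoidAlgebra k S)) (f : AddMonoidAlgebra k S) :
    ∃ g : AddMonoidAlgebra k S, f - g ∈ binomialPart J ∧
      (∀ u ∈ g.coeff.support, mono k u ∉ J) ∧
      ∀ u ∈ g.coeff.support, ∀ v ∈ g.coeff.support, inducedCon J u v → u = v := by
  classical
  induction hn : f.coeff.support.card using Nat.strong_induction_on generalizing f with
  | _ n ih =>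
  -- Induction on the size of the support: it suffices to remove one term by a binomial of `J` that
  -- creates no new term.
  have step : ∀ u ∈ f.coeff.support, ∀ b ∈ binomialPart J,
      (f - b).coeff.support ⊆ f.coeff.support.erase u →
      ∃ g : AddMonoidAlgebra k S, f - g ∈ binomialPart J ∧
        (∀ u ∈ g.coeff.support, mono k u ∉ J) ∧
        ∀ u ∈ g.coeff.support, ∀ v ∈ g.coeff.support, inducedCon J u v → u = v := by
    intro u hu b hb hsub
    obtain ⟨g, hg, h1, h2⟩ := ih (f - b).coeff.support.card
      (hn ▸ (Finset.card_le_card hsub).trans_lt (Finset.card_erase_lt_of_mem hu)) (f - b) rfl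
    refine ⟨g, ?_, h1, h2⟩
    have := (binomialPart J).add_mem hg hb
    rwa [sub_right_comm, sub_add_cancel] at this
  by_cases h1 : ∀ u ∈ f.coeff.support, mono k u ∉ J
  · by_cases h2 : ∀ u ∈ f.coeff.support, ∀ v ∈ f.coeff.support, inducedCon J u v → u = v
    · exact ⟨f, by simp, h1, h2⟩
    · push Not at h2
      obtain ⟨u, hu, v, hv, ⟨c, hc⟩, hne⟩ := h2
      refine step u hu (f.coeff u • (mono k u - (c : k) • mono k v))
        (smul_mem_ideal _ (Ideal.subset_span ⟨hc, _, _, _, rfl⟩)) fun x hx => ?_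
      rw [Finsupp.mem_support_iff, AddMonoidAlgebra.coeff_sub, AddMonoidAlgebra.coeff_smul,
        AddMonoidAlgebra.coeff_sub, AddMonoidAlgebra.coeff_smul] at hx
      simp only [Finsupp.sub_apply, Finsupp.smul_apply, smul_eq_mul] at hx
      rw [Finset.mem_erase]
      have hxu : x ≠ u := by
        rintro rfl
        rw [coeff_mono_self, coeff_mono_of_ne hne.symm] at hx
        simp at hx
      refine ⟨hxu, ?_⟩
      by_cases hxv : x = v
      · exact hxv ▸ hv
      · rw [coeff_mono_of_ne (Ne.symm hxu), coeff_mono_of_ne (Ne.symm hxv)] at hx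
        rw [Finsupp.mem_support_iff]
        simpa using hx
  · push Not at h1
    obtain ⟨u, hu, huJ⟩ := h1
    refine step u hu (f.coeff u • mono k u) (smul_mem_ideal _ (Ideal.subset_span
      ⟨huJ, u, u, 0, by simp⟩)) fun x hx => ?_
    rw [Finsupp.mem_support_iff, AddMonoidAlgebra.coeff_sub, AddMonoidAlgebra.coeff_smul] at hx
    simp only [Finsupp.sub_apply, Finsupp.smul_apply, smul_eq_mul] at hx
    rw [Finset.mem_erase]
    have hxu : x ≠ u := by
      rintro rfl
      rw [coeff_mono_self] at hx
      simp at hx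
    rw [coeff_mono_of_ne (Ne.symm hxu)] at hx
    refine ⟨hxu, ?_⟩
    rw [Finsupp.mem_support_iff]
    simpa using hx

/-- An element lies in `J` if it is killed by enough functionals separating the classes of
monomials. -/
theorem mem_binomialPart_of_functionals {J : Ideal (AddMonoidAlgebra k S)}
    {f : AddMonoidAlgebra k S}
    (h : ∀ u, mono k u ∉ J → ∃ φ : AddMonoidAlgebra k S →ₗ[k] k, (∀ x ∈ J, φ x = 0) ∧
      φ (mono k u) ≠ 0 ∧ (∀ v, ¬ inducedCon J v u → φ (mono k v) = 0) ∧ φ f = 0) :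
    f ∈ binomialPart J := by
  obtain ⟨g, hg, h1, h2⟩ := exists_normalForm J f
  suffices g = 0 by simpa [this] using hg
  by_contra hne
  have hsupp : g.coeff.support.Nonempty := by
    rw [Finsupp.support_nonempty_iff]
    simpa using hne
  obtain ⟨u, hu⟩ := hsupp
  -- The terms of `g` lie in distinct classes, so `φ` sees only the one at `u`.
  obtain ⟨φ, hφJ, hφu, hφ, hφf⟩ := h u (h1 u hu)
  have e := map_eq_of_forall_ne φ g u fun v hv hvu => hφ v fun hc => hvu (h2 v hv u hu hc)
  have e' : φ g = 0 := by
    have := hφJ _ (binomialPart_le J hg)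
    rwa [map_sub, hφf, zero_sub, neg_eq_zero] at this
  rw [e', eq_comm, smul_eq_zero] at e
  exact e.elim (Finsupp.mem_support_iff.1 hu) hφu

theorem IsBinomial.sup {I J : Ideal (AddMonoidAlgebra k S)} (hI : IsBinomial I)
    (hJ : IsBinomial J) : IsBinomial (I ⊔ J) := by
  obtain ⟨A, hA, rfl⟩ := hI
  obtain ⟨B, hB, rfl⟩ := hJ
  exact ⟨A ∪ B, fun f hf => hf.elim (hA f) (hB f), (Ideal.span_union A B).symm⟩

theorem isBinomial_span_mono (A : Set S) :
    IsBinomial (Ideal.span ((fun u => mono k u) '' A)) :=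
  ⟨_, by rintro _ ⟨u, -, rfl⟩; exact ⟨u, u, 0, by simp⟩, rfl⟩

end MonoidAlgebra

/-! ### Monomial localization of ideals and congruences -/

section Localization

variable {k : Type*} [Field k] {Q : Type*} [AddCommMonoid Q]

namespace MonoidPrime

variable (P : MonoidPrime Q)

theorem toLoc_surj (x : P.Loc) : ∃ q, ∃ s ∈ P.face, x + P.toLoc s = P.toLoc q := by
  obtain ⟨⟨q, s⟩, h⟩ := (AddLocalization.addMonoidOf P.face).surj x
  exact ⟨q, s, s.2, h⟩

theorem isAddUnit_toLoc_of_mem_face {s : Q} (hs : s ∈ P.face) : IsAddUnit (P.toLoc s) :=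
  (AddLocalization.addMonoidOf P.face).map_addUnits ⟨s, hs⟩

theorem toLoc_eq_iff {a b : Q} : P.toLoc a = P.toLoc b ↔ ∃ s ∈ P.face, s + a = s + b := by
  refine ((AddLocalization.addMonoidOf P.face).eq_iff_exists).trans ?_
  exact ⟨fun ⟨s, h⟩ => ⟨s, s.2, h⟩, fun ⟨s, hs, h⟩ => ⟨⟨s, hs⟩, h⟩⟩

theorem isAddUnit_toLoc_iff {q : Q} : IsAddUnit (P.toLoc q) ↔ q ∉ P.carrier := by
  refine ⟨fun h hq => ?_, P.isAddUnit_toLoc_of_mem_face⟩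
  obtain ⟨y, hy⟩ := h.exists_neg
  obtain ⟨b, s, hs, hb⟩ := P.toLoc_surj y
  have : P.toLoc (q + b) = P.toLoc s := by
    rw [map_add, ← hb, ← add_assoc, hy, zero_add]
  obtain ⟨t, ht, e⟩ := P.toLoc_eq_iff.1 this
  refine (P.face.add_mem ht hs) (e ▸ ?_)
  rw [add_left_comm]
  exact P.add_mem q hq _

/-- A fraction is a nonunit only if its numerator lies in `P`. This extends conditions imposed on
`P` to all nonunits of `Q_P`. -/
theorem exists_of_not_isAddUnit {x : P.Loc} (hx : ¬ IsAddUnit x) :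
    ∃ p ∈ P.carrier, ∃ g : P.Loc, IsAddUnit g ∧ x = P.toLoc p + g := by
  obtain ⟨p, s, hs, h⟩ := P.toLoc_surj x
  obtain ⟨y, hy⟩ := (P.isAddUnit_toLoc_of_mem_face hs).exists_neg
  refine ⟨p, ?_, y, ⟨⟨y, _, by rw [add_comm]; exact hy, hy⟩, rfl⟩, ?_⟩
  · by_contra hp
    apply hx
    have := P.isAddUnit_toLoc_of_mem_face hp
    rw [← h] at this
    exact isAddUnit_of_add_isAddUnit_left this
  · rw [← h, add_assoc, hy, add_zero]

end MonoidPrime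

variable {P : MonoidPrime Q}

theorem locMap_mono (q : Q) : locMap k P (mono k q) = mono k (P.toLoc q) := by
  simp [locMap, mono]

theorem locMap_smul (c : k) (f : AddMonoidAlgebra k Q) : locMap k P (c • f) = c • locMap k P f := by
  rw [Algebra.smul_def, Algebra.smul_def, map_mul]
  congr 1
  simp [locMap]

/-- `locMap` as a linear map. -/
noncomputable def locLinear (k : Type*) [Field k] {Q : Type*} [AddCommMonoid Q]
    (P : MonoidPrime Q) : AddMonoidAlgebra k Q →ₗ[k] AddMonoidAlgebra k P.Loc where
  toFun := locMap k P
  map_add' := map_add _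
  map_smul' := locMap_smul

theorem locLinear_apply (f : AddMonoidAlgebra k Q) : locLinear k P f = locMap k P f := rfl

theorem locMap_binomial (p q : Q) (c : k) :
    locMap k P (mono k p - c • mono k q) = mono k (P.toLoc p) - c • mono k (P.toLoc q) := by
  rw [map_sub, locMap_smul, locMap_mono, locMap_mono]

theorem exists_mono_mul_eq_locMap (g : AddMonoidAlgebra k P.Loc) :
    ∃ s ∈ P.face, ∃ f, mono k (P.toLoc s) * g = locMap k P f := by
  induction g using mono_induction with
  | zero => exact ⟨0, P.face.zero_mem, 0, by simp⟩
  | add g h hg hh =>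
    obtain ⟨s, hs, f, hf⟩ := hg
    obtain ⟨t, ht, e, he⟩ := hh
    refine ⟨s + t, P.face.add_mem hs ht, mono k t * f + mono k s * e, ?_⟩
    rw [map_add, map_add, map_mul, map_mul, ← hf, ← he, locMap_mono, locMap_mono, mono_add]
    ring
  | smul r u =>
    obtain ⟨q, s, hs, h⟩ := P.toLoc_surj u
    refine ⟨s, hs, r • mono k q, ?_⟩
    rw [locMap_smul, locMap_mono, ← h, mul_smul_comm, mono_add, mul_comm]

theorem exists_mono_mul_eq_zero {f : AddMonoidAlgebra k Q} (hf : locMap k P f = 0) :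
    ∃ s ∈ P.face, mono k s * f = 0 := by
  classical
  -- the pairs identified by the localization generate the kernel
  let N : Ideal (AddMonoidAlgebra k Q) :=
    { carrier := {f | ∃ s ∈ P.face, mono k s * f = 0}
      add_mem' := by
        rintro a b ⟨s, hs, ha⟩ ⟨t, ht, hb⟩
        refine ⟨s + t, P.face.add_mem hs ht, ?_⟩
        rw [mono_add, mul_add, mul_right_comm, ha, zero_mul, zero_add, mul_assoc, hb, mul_zero]
      zero_mem' := ⟨0, P.face.zero_mem, mul_zero _⟩
      smul_mem' := by
        rintro c a ⟨s, hs, ha⟩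
        exact ⟨s, hs, by rw [smul_eq_mul, mul_left_comm, ha, mul_zero]⟩ }
  have hN : ∀ a b : Q, P.toLoc a = P.toLoc b → mono k a - mono k b ∈ N := by
    intro a b h
    obtain ⟨s, hs, e⟩ := P.toLoc_eq_iff.1 h
    exact ⟨s, hs, by rw [mul_sub, ← mono_add, ← mono_add, e, sub_self]⟩
  -- a section of the localization map, as a linear map into the quotient by `N`
  let σ : P.Loc → AddMonoidAlgebra k Q ⧸ N := fun x =>
    if h : ∃ q, P.toLoc q = x then Ideal.Quotient.mk N (mono k h.choose) else 0
  have hσ : ∀ q, σ (P.toLoc q) = Ideal.Quotient.mk N (mono k q) := by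
    intro q
    have h : ∃ q', P.toLoc q' = P.toLoc q := ⟨q, rfl⟩
    simp only [σ]
    rw [dif_pos h]
    exact Ideal.Quotient.eq.2 (hN _ _ h.choose_spec)
  have key : ∀ f, linearExtension (k := k) σ (locMap k P f) = Ideal.Quotient.mk N f := by
    intro f
    induction f using mono_induction with
    | zero => simp
    | add f g hf hg => rw [map_add, map_add, map_add, hf, hg]
    | smul r u =>
      rw [locMap_smul, locMap_mono, map_smul, linearExtension_mono, hσ]
      rfl
  have := key f
  rw [hf, map_zero, eq_comm, Ideal.Quotient.eq_zero_iff_mem] at this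
  exact this

/-- Clearing denominators gives an equality in `k[Q_P]`; a further monomial from the face, from
`exists_mono_mul_eq_zero`, lifts it to `k[Q]`. -/
theorem locMap_mem_locIdeal_iff {I : Ideal (AddMonoidAlgebra k Q)} {f : AddMonoidAlgebra k Q} :
    locMap k P f ∈ locIdeal I P ↔ ∃ s ∈ P.face, mono k s * f ∈ I := by
  constructor
  · intro h
    have key : ∀ g ∈ locIdeal I P, ∃ s ∈ P.face, ∃ e ∈ I,
        mono k (P.toLoc s) * g = locMap k P e := by
      intro g hg
      induction hg using Submodule.span_induction with
      | mem x hx =>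
        obtain ⟨e, he, rfl⟩ := hx
        exact ⟨0, P.face.zero_mem, e, he, by rw [map_zero, mono_zero, one_mul]⟩
      | zero => exact ⟨0, P.face.zero_mem, 0, I.zero_mem, by simp⟩
      | add x y _ _ hx hy =>
        obtain ⟨s, hs, f, hfI, hf⟩ := hx
        obtain ⟨t, ht, e, heI, he⟩ := hy
        refine ⟨s + t, P.face.add_mem hs ht, mono k t * f + mono k s * e,
          I.add_mem (I.mul_mem_left _ hfI) (I.mul_mem_left _ heI), ?_⟩
        rw [map_add, map_add, map_mul, map_mul, ← hf, ← he, locMap_mono, locMap_mono, mono_add]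
        ring
      | smul a x _ hx =>
        obtain ⟨s, hs, f, hfI, hf⟩ := hx
        obtain ⟨t, ht, e, he⟩ := exists_mono_mul_eq_locMap (P := P) a
        refine ⟨s + t, P.face.add_mem hs ht, e * f, I.mul_mem_left _ hfI, ?_⟩
        rw [map_add, map_mul, ← hf, ← he, mono_add, smul_eq_mul]
        ring
    obtain ⟨s, hs, e, he, h⟩ := key _ h
    have h0 : locMap k P (mono k s * f - e) = 0 := by
      rw [map_sub, map_mul, locMap_mono, h, sub_self]
    obtain ⟨t, ht, h1⟩ := exists_mono_mul_eq_zero h0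
    refine ⟨t + s, P.face.add_mem ht hs, ?_⟩
    rw [mul_sub, sub_eq_zero, ← mul_assoc, ← mono_add] at h1
    rw [h1]
    exact I.mul_mem_left _ he
  · rintro ⟨s, hs, h⟩
    rw [← mono_mul_mem_iff_of_isAddUnit (P.isAddUnit_toLoc_of_mem_face hs), ← locMap_mono,
      ← map_mul]
    exact Ideal.mem_map_of_mem _ h

theorem locMap_mem_locIdeal {I : Ideal (AddMonoidAlgebra k Q)} {f : AddMonoidAlgebra k Q}
    (h : f ∈ I) : locMap k P f ∈ locIdeal I P :=
  Ideal.mem_map_of_mem _ h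

theorem locIdeal_comap (J : Ideal (AddMonoidAlgebra k P.Loc)) :
    locIdeal (J.comap (locMap k P)) P = J := by
  refine le_antisymm Ideal.map_comap_le fun g hg => ?_
  obtain ⟨s, hs, f, hf⟩ := exists_mono_mul_eq_locMap g
  rw [← mono_mul_mem_iff_of_isAddUnit (P.isAddUnit_toLoc_of_mem_face hs), hf]
  refine locMap_mem_locIdeal (Ideal.mem_comap.2 ?_)
  rw [← hf]
  exact J.mul_mem_left _ hg

theorem IsBinomial.locIdeal {I : Ideal (AddMonoidAlgebra k Q)} (hI : IsBinomial I) :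
    IsBinomial (locIdeal I P) := by
  obtain ⟨T, hT, rfl⟩ := hI
  refine ⟨locMap k P '' T, ?_, Ideal.map_span _ _⟩
  rintro _ ⟨f, hf, rfl⟩
  obtain ⟨p, q, c, rfl⟩ := hT f hf
  exact ⟨_, _, c, locMap_binomial p q c⟩

theorem inducedCon_comap_iff {J : Ideal (AddMonoidAlgebra k P.Loc)} {p q : Q} :
    inducedCon (J.comap (locMap k P)) p q ↔ inducedCon J (P.toLoc p) (P.toLoc q) := by
  simp only [inducedCon_iff, Ideal.mem_comap, locMap_binomial]

/-- No generators are exhibited: the separating functionals of `J` pull back along the localization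
map, and they characterize binomial ideals. -/
theorem IsBinomial.comap_locMap {J : Ideal (AddMonoidAlgebra k P.Loc)} (hJ : IsBinomial J) :
    IsBinomial (J.comap (locMap k P)) := by
  refine isBinomial_of_le_binomialPart fun f hf => mem_binomialPart_of_functionals fun u hu => ?_
  rw [Ideal.mem_comap, locMap_mono] at hu
  obtain ⟨φ, h1, h2, h3⟩ := hJ.exists_functional hu
  refine ⟨φ ∘ₗ locLinear k P, fun x hx => h1 _ hx, ?_, fun v hv => ?_, h1 _ hf⟩
  · rw [LinearMap.comp_apply, locLinear_apply, locMap_mono, h2]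
    exact one_ne_zero
  · rw [LinearMap.comp_apply, locLinear_apply, locMap_mono]
    exact h3 _ fun h => hv (inducedCon_comap_iff.2 h)

theorem con_add_isAddUnit_right_iff {M : Type*} [AddCommMonoid M] (c : AddCon M) {x y g : M}
    (hg : IsAddUnit g) : c (x + g) (y + g) ↔ c x y := by
  refine ⟨fun h => ?_, fun h => c.add h (c.refl g)⟩
  obtain ⟨g', hg'⟩ := hg.exists_neg
  have := c.add h (c.refl g')
  rwa [add_assoc, add_assoc, hg', add_zero, add_zero] at this

/-- Localization commutes with taking the induced congruence. -/
theorem locCon_inducedCon (I : Ideal (AddMonoidAlgebra k Q)) (P : MonoidPrime Q) :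
    locCon (inducedCon I) P = inducedCon (locIdeal I P) := by
  apply le_antisymm
  · refine AddCon.addConGen_le.2 ?_
    rintro x y ⟨a, b, ⟨c, hc⟩, rfl, rfl⟩
    exact ⟨c, by rw [← locMap_binomial]; exact locMap_mem_locIdeal hc⟩
  · rintro x y ⟨c, hc⟩
    obtain ⟨a, s, hs, ha⟩ := P.toLoc_surj x
    obtain ⟨b, t, ht, hb⟩ := P.toLoc_surj y
    -- Multiplication by `t^{s+t}` clears the denominators of `x = a - s` and `y = b - t`.
    have hmem : locMap k P (mono k (a + t) - (c : k) • mono k (b + s)) ∈ locIdeal I P := by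
      have := (locIdeal I P).mul_mem_left (mono k (P.toLoc (s + t))) hc
      rw [mono_mul_binomial] at this
      rw [locMap_binomial]
      convert this using 3
      · rw [map_add, map_add, ← ha]; abel
      · rw [map_add, map_add, ← hb]; abel_nf
    obtain ⟨r, hr, h⟩ := locMap_mem_locIdeal_iff.1 hmem
    rw [mono_mul_binomial] at h
    have hcon : (inducedCon I) (r + (a + t)) (r + (b + s)) := ⟨c, h⟩
    have h2 : locCon (inducedCon I) P (P.toLoc (r + (a + t))) (P.toLoc (r + (b + s))) :=
      AddConGen.Rel.of _ _ ⟨_, _, hcon, rfl, rfl⟩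
    have hu : IsAddUnit (P.toLoc (r + (s + t))) :=
      P.isAddUnit_toLoc_of_mem_face (P.face.add_mem hr (P.face.add_mem hs ht))
    rw [← con_add_isAddUnit_right_iff _ hu]
    convert h2 using 1
    · simp only [map_add, ← ha]; abel
    · simp only [map_add, ← hb]; abel

end Localization

/-! ### Green's preorder modulo `I_P` and characters at a monomial -/

section Characters

variable {k : Type*} [Field k] {Q : Type*} [AddCommMonoid Q]

/-- `x` precedes `w` in Green's preorder modulo the congruence of `I_P`. -/
def LocLE (I : Ideal (AddMonoidAlgebra k Q)) (P : MonoidPrime Q) (x w : P.Loc) : Prop :=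
  ∃ u : P.Loc, inducedCon (locIdeal I P) (x + u) w

variable {P : MonoidPrime Q}

theorem greenLE_mk_iff {M : Type*} [AddCommMonoid M] (c : AddCon M) (x y : M) :
    GreenLE (x : c.Quotient) (y : c.Quotient) ↔ ∃ u, c (x + u) y := by
  constructor
  · rintro ⟨u, hu⟩
    induction u using AddCon.induction_on with
    | H u => exact ⟨u, (AddCon.eq c).1 (by rw [AddCon.coe_add]; exact hu)⟩
  · rintro ⟨u, hu⟩
    exact ⟨u, by rw [← AddCon.coe_add]; exact (AddCon.eq c).2 hu⟩

theorem toLocQuot_apply (c : AddCon Q) (q : Q) :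
    toLocQuot c P q = ((P.toLoc q : P.Loc) : LocQuot c P) := rfl

theorem mk_eq_mk_iff (I : Ideal (AddMonoidAlgebra k Q)) (x y : P.Loc) :
    (x : LocQuot (inducedCon I) P) = (y : LocQuot (inducedCon I) P) ↔
      inducedCon (locIdeal I P) x y := by
  rw [AddCon.eq, locCon_inducedCon]

theorem greenLE_iff_locLE {I : Ideal (AddMonoidAlgebra k Q)} {x w : P.Loc} :
    GreenLE (x : LocQuot (inducedCon I) P) (w : LocQuot (inducedCon I) P) ↔ LocLE I P x w := by
  rw [greenLE_mk_iff, locCon_inducedCon, LocLE]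

theorem mem_orderIdeal_iff {I : Ideal (AddMonoidAlgebra k Q)} {a w : Q} :
    a ∈ orderIdeal (inducedCon I) P w ↔ LocLE I P (P.toLoc a) (P.toLoc w) :=
  greenLE_iff_locLE

theorem mem_stabilizer_iff {I : Ideal (AddMonoidAlgebra k Q)} {w : Q} {g : AddUnits P.Loc} :
    g ∈ stabilizer I P w ↔
      inducedCon (locIdeal I P) ((g : P.Loc) + P.toLoc w) (P.toLoc w) := by
  rw [← locCon_inducedCon]
  exact Iff.rfl

variable {I : Ideal (AddMonoidAlgebra k Q)}

theorem LocLE.refl (x : P.Loc) : LocLE I P x x :=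
  ⟨0, by rw [add_zero]; exact (inducedCon _).refl x⟩

theorem LocLE.trans {x y z : P.Loc} (h : LocLE I P x y) (h' : LocLE I P y z) : LocLE I P x z := by
  obtain ⟨u, hu⟩ := h
  obtain ⟨v, hv⟩ := h'
  refine ⟨u + v, ?_⟩
  rw [← add_assoc]
  exact (inducedCon _).trans ((inducedCon _).add hu ((inducedCon _).refl v)) hv

theorem LocLE.of_add {x y z : P.Loc} (h : LocLE I P (x + y) z) : LocLE I P x z := by
  obtain ⟨u, hu⟩ := h
  exact ⟨y + u, by rwa [← add_assoc]⟩

theorem LocLE.of_con {x y : P.Loc} (h : inducedCon (locIdeal I P) x y) : LocLE I P x y :=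
  ⟨0, by rwa [add_zero]⟩

theorem locLE_add_unit_iff {x g w : P.Loc} (hg : IsAddUnit g) :
    LocLE I P (x + g) w ↔ LocLE I P x w := by
  refine ⟨LocLE.of_add, ?_⟩
  rintro ⟨u, hu⟩
  obtain ⟨g', hg'⟩ := hg.exists_neg
  refine ⟨g' + u, ?_⟩
  rwa [add_assoc, ← add_assoc g, hg', zero_add]

theorem mono_mem_primeMonomialIdeal {x : P.Loc} (hx : ¬ IsAddUnit x) :
    mono k x ∈ primeMonomialIdeal k P := by
  obtain ⟨p, hp, g, -, rfl⟩ := P.exists_of_not_isAddUnit hx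
  have : mono k (P.toLoc p) ∈ primeMonomialIdeal k P := Ideal.subset_span ⟨p, hp, rfl⟩
  exact mono_add_mem this g

section CharacterIdeal

variable {K : AddSubgroup (AddUnits P.Loc)} (ρ : Multiplicative K →* kˣ)

theorem isBinomial_characterIdeal : IsBinomial (characterIdeal ρ) :=
  ⟨_, by rintro _ ⟨g, v, rfl⟩; exact ⟨_, _, _, rfl⟩, rfl⟩

/-- The character ideal, together with the nonunit monomials, is a proper ideal which determines
the character. -/
theorem exists_character_functional : ∃ φ : AddMonoidAlgebra k P.Loc →ₗ[k] k,
    (∀ f ∈ characterIdeal ρ ⊔ primeMonomialIdeal k P, φ f = 0) ∧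
      ∀ g : K, φ (mono k ((g : AddUnits P.Loc) : P.Loc)) = (ρ (Multiplicative.ofAdd g) : k) := by
  classical
  -- `ρ` extended by zero. It vanishes on nonunits, which kills `m_P`, and its support is stable
  -- under translation by `K`, which makes it kill the character binomials.
  let χ : P.Loc → k := fun u =>
    if h : ∃ g : K, ((g : AddUnits P.Loc) : P.Loc) = u then
      (ρ (Multiplicative.ofAdd h.choose) : k) else 0
  have hχ : ∀ g : K, χ ((g : AddUnits P.Loc) : P.Loc) = (ρ (Multiplicative.ofAdd g) : k) := by
    intro g
    have h : ∃ g' : K, ((g' : AddUnits P.Loc) : P.Loc) = ((g : AddUnits P.Loc) : P.Loc) :=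
      ⟨g, rfl⟩
    have e : h.choose = g := Subtype.ext (AddUnits.ext h.choose_spec)
    simp only [χ]
    rw [dif_pos h, e]
  have hχ0 : ∀ u, (∀ g : K, ((g : AddUnits P.Loc) : P.Loc) ≠ u) → χ u = 0 := by
    intro u hu
    exact dif_neg fun ⟨g, hg⟩ => hu g hg
  refine ⟨linearExtension χ, ?_, fun g => by rw [linearExtension_mono, hχ]⟩
  intro f hf
  rw [characterIdeal, primeMonomialIdeal, ← Ideal.span_union] at hf
  refine mem_of_mem_ideal_span (LinearMap.ker (linearExtension χ)) ?_ hf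
  rintro a f (⟨g, v, rfl⟩ | ⟨p, hp, rfl⟩)
  · rw [mono_mul_binomial, LinearMap.mem_ker, map_sub, map_smul, linearExtension_mono,
      linearExtension_mono, add_left_comm, smul_eq_mul, sub_eq_zero]
    by_cases h : ∃ g' : K, ((g' : AddUnits P.Loc) : P.Loc) = a + v
    · obtain ⟨g', hg'⟩ := h
      have : ((g : AddUnits P.Loc) : P.Loc) + (a + v)
          = (((g + g' : K) : AddUnits P.Loc) : P.Loc) := by
        rw [← hg']; simp
      rw [this, hχ, ← hg', hχ, ofAdd_add, map_mul, Units.val_mul]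
    · rw [hχ0 (a + v) fun g' hg' => h ⟨g', hg'⟩, mul_zero]
      refine hχ0 _ fun g' hg' => h ⟨-g + g', ?_⟩
      have : (((-g + g' : K) : AddUnits P.Loc) : P.Loc)
          = ((-(g : AddUnits P.Loc) : AddUnits P.Loc) : P.Loc)
            + ((g' : AddUnits P.Loc) : P.Loc) := by simp
      rw [this, hg', AddUnits.neg_add_cancel_left]
  · rw [← mono_add, LinearMap.mem_ker, linearExtension_mono]
    refine hχ0 _ fun g hg => ?_
    have : IsAddUnit (a + P.toLoc p) := ⟨_, hg⟩
    exact P.isAddUnit_toLoc_iff.1 (isAddUnit_of_add_isAddUnit_right this) hp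

theorem one_notMem_characterIdeal_sup :
    (1 : AddMonoidAlgebra k P.Loc) ∉ characterIdeal ρ ⊔ primeMonomialIdeal k P := by
  intro h
  obtain ⟨φ, h0, h1⟩ := exists_character_functional ρ
  have h2 := h1 0
  have h3 := h0 _ h
  rw [← mono_zero] at h3
  rw [ofAdd_zero, map_one] at h2
  exact one_ne_zero (α := k) (by simpa [h3] using h2.symm)

/-- A colon ideal of a binomial ideal by a monomial, modulo the nonunit monomials, is given by the
character on the stabilizer of the monomial, provided that no nonunit moves the monomial within its
orbit. -/
theorem colon_sup_eq_characterIdeal_sup {J : Ideal (AddMonoidAlgebra k P.Loc)} (hJ : IsBinomial J)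
    {x : P.Loc} (hx : mono k x ∉ J)
    (hρ : ∀ g : K, mono k (((g : AddUnits P.Loc) : P.Loc) + x)
      - (ρ (Multiplicative.ofAdd g) : k) • mono k x ∈ J)
    (hK : ∀ (u : P.Loc) (g : AddUnits P.Loc), inducedCon J (u + x) ((g : P.Loc) + x) →
      ∃ h : K, u = ((h : AddUnits P.Loc) : P.Loc) + g) :
    J.colon {mono k x} ⊔ primeMonomialIdeal k P = characterIdeal ρ ⊔ primeMonomialIdeal k P := by
  have hle : characterIdeal ρ ≤ J.colon {mono k x} := by
    refine Ideal.span_le.2 ?_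
    rintro _ ⟨g, v, rfl⟩
    rw [SetLike.mem_coe, Submodule.mem_colon_singleton, smul_eq_mul, mul_comm, mono_mul_binomial]
    have := J.mul_mem_left (mono k v) (hρ g)
    rw [mono_mul_binomial] at this
    convert this using 2
    · rw [add_left_comm, add_comm x v, add_left_comm]
    · rw [add_comm x v]
  refine le_antisymm (sup_le (fun f hf => ?_) le_sup_right) (sup_le_sup_right hle _)
  refine binomialPart_le _ (mem_binomialPart_of_functionals fun u hu => ?_)
  have hunit : IsAddUnit u := by
    by_contra h
    exact hu (Ideal.mem_sup_right (mono_mem_primeMonomialIdeal h))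
  obtain ⟨g, rfl⟩ := hunit
  have hgx : mono k ((g : P.Loc) + x) ∉ J := by
    rw [mono_add, mono_mul_mem_iff_of_isAddUnit g.isAddUnit]
    exact hx
  -- The functional of `J` at `g + x`, composed with multiplication by `t^x`, kills the colon ideal.
  -- By `hK` it also kills `m_P` and separates the classes of units modulo `I_ρ + m_P`.
  obtain ⟨φ, h1, h2, h3⟩ := hJ.exists_functional hgx
  have hφ : ∀ f, (φ ∘ₗ LinearMap.mulRight k (mono k x)) f = φ (f * mono k x) := fun f => rfl
  refine ⟨φ ∘ₗ LinearMap.mulRight k (mono k x), fun f hf => ?_, ?_, fun v hv => ?_, ?_⟩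
  · obtain ⟨a, ha, b, hb, rfl⟩ := Submodule.mem_sup.1 hf
    rw [hφ, add_mul, map_add]
    have e1 : φ (a * mono k x) = 0 := h1 _ (Submodule.mem_colon_singleton.1 (hle ha))
    have e2 : φ (b * mono k x) = 0 := by
      rw [← hφ, ← LinearMap.mem_ker]
      refine mem_of_mem_ideal_span _ ?_ hb
      rintro a _ ⟨p, hp, rfl⟩
      rw [LinearMap.mem_ker, hφ, ← mono_add, ← mono_add]
      refine h3 _ fun hc => ?_
      obtain ⟨h, hh⟩ := hK _ _ hc
      have : IsAddUnit (a + P.toLoc p) := hh ▸ (((h : AddUnits P.Loc) + g).isAddUnit)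
      exact P.isAddUnit_toLoc_iff.1 (isAddUnit_of_add_isAddUnit_right this) hp
    rw [e1, e2, add_zero]
  · rw [hφ, ← mono_add, h2]
    exact one_ne_zero
  · rw [hφ, ← mono_add]
    refine h3 _ fun hc => hv ?_
    obtain ⟨h, rfl⟩ := hK _ _ hc
    exact ⟨ρ (Multiplicative.ofAdd h), Ideal.mem_sup_left (Ideal.subset_span ⟨h, g, rfl⟩)⟩
  · rw [hφ]
    exact h1 _ (Submodule.mem_colon_singleton.1 hf)

end CharacterIdeal

theorem IsCharacterAt.mono_notMem {w : Q} {ρ : Multiplicative (stabilizer I P w) →* kˣ}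
    (hρ : IsCharacterAt I P w ρ) : mono k (P.toLoc w) ∉ locIdeal I P := by
  intro h
  apply one_notMem_characterIdeal_sup ρ
  unfold IsCharacterAt at hρ
  rw [hρ]
  refine Ideal.mem_sup_left (Submodule.mem_colon_singleton.2 ?_)
  simpa using h

/-- An element of the stabilizer comes with some scalar `c`, so `t^g - c` lies in `I_ρ + m_P`; the
functional of `exists_character_functional` then reads off `c = ρ(g)`. -/
theorem IsCharacterAt.sub_mem {w : Q} {ρ : Multiplicative (stabilizer I P w) →* kˣ}
    (hρ : IsCharacterAt I P w ρ) (g : stabilizer I P w) :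
    mono k (((g : AddUnits P.Loc) : P.Loc) + P.toLoc w)
      - (ρ (Multiplicative.ofAdd g) : k) • mono k (P.toLoc w) ∈ locIdeal I P := by
  obtain ⟨c, hc⟩ := mem_stabilizer_iff.1 g.2
  have hcolon : mono k ((g : AddUnits P.Loc) : P.Loc) - (c : k) • mono k 0
      ∈ characterIdeal ρ ⊔ primeMonomialIdeal k P := by
    unfold IsCharacterAt at hρ
    rw [hρ]
    refine Ideal.mem_sup_left (Submodule.mem_colon_singleton.2 ?_)
    rw [smul_eq_mul, mul_comm, mono_mul_binomial, add_zero, add_comm]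
    exact hc
  obtain ⟨φ, h0, h1⟩ := exists_character_functional ρ
  have h2 := h0 _ hcolon
  have h3 := h1 0
  rw [ofAdd_zero, map_one, Units.val_one] at h3
  have h4 : ((((0 : stabilizer I P w)) : AddUnits P.Loc) : P.Loc) = 0 := rfl
  rw [h4] at h3
  rw [map_sub, map_smul, h1, h3, smul_eq_mul, mul_one, sub_eq_zero] at h2
  rw [h2]
  exact hc

/-- If `x + u + w ~ w`, then `t^{x+u} - c` lies in the colon ideal and `t^{x+u}` in `m_P`, so the
nonzero scalar `c` lies in `I_ρ + m_P`, which is proper. -/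
theorem IsCharacterAt.not_locLE {w : Q} {ρ : Multiplicative (stabilizer I P w) →* kˣ}
    (hρ : IsCharacterAt I P w ρ) {x : P.Loc} (hx : ¬ IsAddUnit x) :
    ¬ LocLE I P (x + P.toLoc w) (P.toLoc w) := by
  rintro ⟨u, c, hc⟩
  apply one_notMem_characterIdeal_sup ρ
  have hm : mono k (x + u) ∈ characterIdeal ρ ⊔ primeMonomialIdeal k P :=
    Ideal.mem_sup_right (mono_add_mem (mono_mem_primeMonomialIdeal hx) u)
  have hcolon : mono k (x + u) - (c : k) • mono k 0
      ∈ characterIdeal ρ ⊔ primeMonomialIdeal k P := by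
    unfold IsCharacterAt at hρ
    rw [hρ]
    refine Ideal.mem_sup_left (Submodule.mem_colon_singleton.2 ?_)
    rw [smul_eq_mul, mul_comm, mono_mul_binomial, add_zero]
    rwa [add_left_comm, ← add_assoc]
  rw [← mono_zero]
  exact (mono_mem_iff_of_sub_mem c.ne_zero hcolon).1 hm

/-- The difference `u - g` fixes the class of `w`, hence by `h` it cannot be a nonunit. This
supplies the last hypothesis of `colon_sup_eq_characterIdeal_sup`. -/
theorem exists_stabilizer_of_con {w : Q}
    (h : ∀ x : P.Loc, ¬ IsAddUnit x → ¬ LocLE I P (x + P.toLoc w) (P.toLoc w))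
    (u : P.Loc) (g : AddUnits P.Loc)
    (hu : inducedCon (locIdeal I P) (u + P.toLoc w) ((g : P.Loc) + P.toLoc w)) :
    ∃ h : stabilizer I P w, u = ((h : AddUnits P.Loc) : P.Loc) + g := by
  have hu' : inducedCon (locIdeal I P) (u + ((-g : AddUnits P.Loc) : P.Loc) + P.toLoc w)
      (P.toLoc w) := by
    have := (inducedCon (locIdeal I P)).add ((inducedCon (locIdeal I P)).refl
      ((-g : AddUnits P.Loc) : P.Loc)) hu
    rw [AddUnits.neg_add_cancel_left, ← add_assoc, add_comm _ u] at this
    exact this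
  have hunit : IsAddUnit (u + ((-g : AddUnits P.Loc) : P.Loc)) := by
    by_contra hn
    exact h _ hn (LocLE.of_con hu')
  obtain ⟨r, hr⟩ := hunit
  rw [← hr] at hu'
  refine ⟨⟨r, mem_stabilizer_iff.2 hu'⟩, ?_⟩
  change u = (r : P.Loc) + g
  rw [hr, add_assoc, AddUnits.neg_add, add_zero]

/-- A monomial that no nonunit moves within its orbit has a unique character. -/
theorem existsUnique_isCharacterAt (hI : IsBinomial I) {w : Q}
    (hw : mono k (P.toLoc w) ∉ locIdeal I P)
    (h : ∀ x : P.Loc, ¬ IsAddUnit x → ¬ LocLE I P (x + P.toLoc w) (P.toLoc w)) :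
    ∃! ρ : Multiplicative (stabilizer I P w) →* kˣ, IsCharacterAt I P w ρ := by
  have key : ∀ g : stabilizer I P w, ∃ c : kˣ,
      mono k (((g : AddUnits P.Loc) : P.Loc) + P.toLoc w) - (c : k) • mono k (P.toLoc w)
        ∈ locIdeal I P := fun g => mem_stabilizer_iff.1 g.2
  choose χ hχ using key
  have hadd : ∀ g g' : stabilizer I P w, χ (g + g') = χ g * χ g' := by
    intro g g'
    refine Units.ext (scalar_unique hw (hχ (g + g')) ?_)
    have h1 := (locIdeal I P).mul_mem_left (mono k ((g : AddUnits P.Loc) : P.Loc)) (hχ g')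
    have h2 := (locIdeal I P).add_mem h1 (smul_mem_ideal (χ g' : k) (hχ g))
    rw [mono_mul_binomial, smul_sub, smul_smul, sub_add_sub_cancel, ← add_assoc] at h2
    rw [Units.val_mul, mul_comm]
    exact h2
  let ρ : Multiplicative (stabilizer I P w) →* kˣ :=
    { toFun := fun g => χ g.toAdd
      map_one' := by
        have := hadd 0 0
        rw [add_zero] at this
        exact mul_eq_left.1 this.symm
      map_mul' := fun g g' => hadd _ _ }
  refine ⟨ρ, ?_, fun ρ' hρ' => ?_⟩
  · exact (colon_sup_eq_characterIdeal_sup ρ hI.locIdeal hw hχ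
      (exists_stabilizer_of_con h)).symm
  · refine MonoidHom.ext fun g => Units.ext ?_
    exact scalar_unique hw (hρ'.sub_mem g.toAdd) (hχ g.toAdd)

theorem not_locLE_of_forall_mem {w : Q}
    (h : ∀ p ∈ P.carrier, ¬ LocLE I P (P.toLoc p + P.toLoc w) (P.toLoc w))
    (x : P.Loc) (hx : ¬ IsAddUnit x) : ¬ LocLE I P (x + P.toLoc w) (P.toLoc w) := by
  obtain ⟨p, hp, g, hg, rfl⟩ := P.exists_of_not_isAddUnit hx
  rw [add_right_comm, locLE_add_unit_iff hg]
  exact h p hp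

end Characters

/-! ### Nil, cancellative and nilpotent elements -/

section Monoid

variable {M : Type*} [AddCommMonoid M]

/-- A cancellative absorbing element collapses the monoid to one point, where the convention admits
no nil. -/
theorem not_isNil_of_isCancellative {x : M} (hc : IsCancellative x) : ¬ IsNil x := by
  rintro ⟨⟨y, hy⟩, hx⟩
  have h0 : ∀ z : M, z = 0 := fun z => hc _ _ (by rw [add_zero, add_comm, hx])
  exact hy ((h0 y).trans (h0 x).symm)

theorem IsCancellative.nsmul {x : M} (hc : IsCancellative x) (n : ℕ) : IsCancellative (n • x) := by
  induction n with
  | zero => intro a b h; simpa using h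
  | succ n ih =>
    intro a b h
    rw [succ_nsmul, add_assoc, add_assoc] at h
    exact hc _ _ (ih _ _ h)

theorem IsCancellative.not_isNilpotentElt {x : M} (hc : IsCancellative x) :
    ¬ IsNilpotentElt x :=
  fun ⟨n, hn⟩ => not_isNil_of_isCancellative (hc.nsmul n) hn

theorem isCancellative_of_isAddUnit {x : M} (hx : IsAddUnit x) : IsCancellative x :=
  fun _ _ h => hx.add_left_cancel h

theorem GreenLE.trans {x y z : M} (h : GreenLE x y) (h' : GreenLE y z) : GreenLE x z := by
  obtain ⟨u, rfl⟩ := h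
  obtain ⟨v, rfl⟩ := h'
  exact ⟨u + v, (add_assoc _ _ _).symm⟩

theorem IsNil.add {x : M} (h : IsNil x) (y : M) : IsNil (x + y) := by
  rw [add_comm, h.2]; exact h

/-- The monomial outside `J` provides the second class that the convention on one-element monoids
requires. -/
theorem isNil_mk_of_mono_mem {k : Type*} [Field k] {J : Ideal (AddMonoidAlgebra k M)} {c : AddCon M}
    (hc : c = inducedCon J) {x y : M} (hx : mono k x ∈ J) (hy : mono k y ∉ J) :
    IsNil (x : c.Quotient) := by
  subst hc
  refine ⟨⟨(y : (inducedCon J).Quotient), fun h => hy ?_⟩, fun z => ?_⟩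
  · exact (mono_mem_iff_of_inducedCon ((AddCon.eq _).1 h)).2 hx
  · induction z using AddCon.induction_on with
    | H z =>
      rw [← AddCon.coe_add, AddCon.eq, add_comm]
      exact inducedCon_of_mono_mem (mono_add_mem hx z) hx

end Monoid

/-! ### The component cogenerated by `w`: congruence, maximality, coprincipality -/

section Component

variable {k : Type*} [Field k] {Q : Type*} [AddCommMonoid Q] {P : MonoidPrime Q}
  {I : Ideal (AddMonoidAlgebra k Q)} {w : Q}

theorem con_add_left {J : Ideal (AddMonoidAlgebra k P.Loc)} {x y : P.Loc} (h : inducedCon J x y)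
    (z : P.Loc) : inducedCon J (z + x) (z + y) :=
  (inducedCon J).add ((inducedCon J).refl z) h

theorem con_add_right {J : Ideal (AddMonoidAlgebra k P.Loc)} {x y : P.Loc} (h : inducedCon J x y)
    (z : P.Loc) : inducedCon J (x + z) (y + z) :=
  (inducedCon J).add h ((inducedCon J).refl z)

theorem inducedCon_mono {S : Type*} [AddCommMonoid S] {J J' : Ideal (AddMonoidAlgebra k S)}
    (h : J ≤ J') {x y : S} (hxy : inducedCon J x y) : inducedCon J' x y := by
  obtain ⟨c, hc⟩ := hxy
  exact ⟨c, h hc⟩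

theorem locLE_iff_of_con {x y : P.Loc} {h : AddUnits P.Loc}
    (hxy : inducedCon (locIdeal I P) x ((h : P.Loc) + y)) {z : P.Loc} :
    LocLE I P x z ↔ LocLE I P y z := by
  rw [← locLE_add_unit_iff (x := y) h.isAddUnit, add_comm y]
  exact ⟨fun H => (LocLE.of_con ((inducedCon _).symm hxy)).trans H,
    fun H => (LocLE.of_con hxy).trans H⟩

/-- The congruence on `Q_P` of the component cogenerated by `w`: the elements that do not precede
`w` are joined together, and the others up to the action of the stabilizer of `w`. -/
def componentCon (I : Ideal (AddMonoidAlgebra k Q)) (P : MonoidPrime Q) (w : Q) : AddCon P.Loc where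
  r x y := (¬ LocLE I P x (P.toLoc w) ∧ ¬ LocLE I P y (P.toLoc w)) ∨
    ∃ h ∈ stabilizer I P w, inducedCon (locIdeal I P) x ((h : P.Loc) + y)
  iseqv :=
    { refl := fun x => Or.inr ⟨0, (stabilizer I P w).zero_mem, by
        rw [AddUnits.val_zero, zero_add]; exact (inducedCon _).refl x⟩
      symm := by
        rintro x y (⟨h1, h2⟩ | ⟨h, hh, hxy⟩)
        · exact Or.inl ⟨h2, h1⟩
        · refine Or.inr ⟨-h, (stabilizer I P w).neg_mem hh, ?_⟩
          have := con_add_left ((inducedCon _).symm hxy) ((-h : AddUnits P.Loc) : P.Loc)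
          rwa [AddUnits.neg_add_cancel_left] at this
      trans := by
        rintro x y z (⟨h1, h2⟩ | ⟨h, hh, hxy⟩) (⟨h3, h4⟩ | ⟨h', hh', hyz⟩)
        · exact Or.inl ⟨h1, h4⟩
        · exact Or.inl ⟨h1, fun H => h2 ((locLE_iff_of_con hyz).2 H)⟩
        · exact Or.inl ⟨fun H => h3 ((locLE_iff_of_con hxy).1 H), h4⟩
        · refine Or.inr ⟨h + h', (stabilizer I P w).add_mem hh hh', ?_⟩
          rw [AddUnits.val_add, add_assoc]
          exact (inducedCon _).trans hxy (con_add_left hyz _) }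
  add' := by
    rintro x y z t (⟨h1, h2⟩ | ⟨h, hh, hxy⟩) (⟨h3, h4⟩ | ⟨h', hh', hzt⟩)
    · exact Or.inl ⟨fun H => h1 H.of_add, fun H => h2 H.of_add⟩
    · exact Or.inl ⟨fun H => h1 H.of_add, fun H => h2 H.of_add⟩
    · exact Or.inl ⟨fun H => h3 (LocLE.of_add (by rwa [add_comm] at H)),
        fun H => h4 (LocLE.of_add (by rwa [add_comm] at H))⟩
    · refine Or.inr ⟨h + h', (stabilizer I P w).add_mem hh hh', ?_⟩
      rw [AddUnits.val_add, add_add_add_comm]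
      exact (inducedCon _).add hxy hzt

theorem componentCon_iff {x y : P.Loc} : componentCon I P w x y ↔
    (¬ LocLE I P x (P.toLoc w) ∧ ¬ LocLE I P y (P.toLoc w)) ∨
      ∃ h ∈ stabilizer I P w, inducedCon (locIdeal I P) x ((h : P.Loc) + y) :=
  Iff.rfl

variable {ρ : Multiplicative (stabilizer I P w) →* kˣ}

/-- The localization of the component cogenerated by `w`. -/
noncomputable def locComponent (I : Ideal (AddMonoidAlgebra k Q)) (P : MonoidPrime Q) (w : Q)
    (ρ : Multiplicative (stabilizer I P w) →* kˣ) : Ideal (AddMonoidAlgebra k P.Loc) :=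
  locIdeal I P ⊔ characterIdeal ρ ⊔ (cogeneratedMonomialIdeal I P w).map (locMap k P)

theorem component_eq : component I P w ρ = (locComponent I P w ρ).comap (locMap k P) := rfl

theorem locIdeal_component : locIdeal (component I P w ρ) P = locComponent I P w ρ :=
  locIdeal_comap _

theorem locIdeal_le_locComponent : locIdeal I P ≤ locComponent I P w ρ :=
  le_sup_left.trans le_sup_left

theorem characterIdeal_le_locComponent : characterIdeal ρ ≤ locComponent I P w ρ :=
  le_sup_right.trans le_sup_left

theorem le_component : I ≤ component I P w ρ := fun _ hf =>
  Ideal.mem_comap.2 (locIdeal_le_locComponent (locMap_mem_locIdeal hf))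

theorem map_cogeneratedMonomialIdeal :
    (cogeneratedMonomialIdeal I P w).map (locMap k P) =
      Ideal.span ((fun u : P.Loc => mono k u) ''
        (P.toLoc '' {u | ¬ LocLE I P (P.toLoc u) (P.toLoc w)})) := by
  rw [cogeneratedMonomialIdeal, Ideal.map_span, Set.image_image, Set.image_image]
  congr 1
  ext f
  simp only [Set.mem_image, Set.mem_compl_iff, mem_orderIdeal_iff, locMap_mono, Set.mem_ofPred_eq]

theorem mono_mem_locComponent {x : P.Loc} (hx : ¬ LocLE I P x (P.toLoc w)) :
    mono k x ∈ locComponent I P w ρ := by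
  obtain ⟨q, s, hs, h⟩ := P.toLoc_surj x
  have hu := P.isAddUnit_toLoc_of_mem_face hs
  have hq : ¬ LocLE I P (P.toLoc q) (P.toLoc w) := by
    rwa [← h, locLE_add_unit_iff hu]
  have hmem : mono k (P.toLoc q) ∈ locComponent I P w ρ := by
    refine Ideal.mem_sup_right ?_
    rw [map_cogeneratedMonomialIdeal]
    exact Ideal.subset_span ⟨_, ⟨q, hq, rfl⟩, rfl⟩
  rwa [← h, add_comm, mono_add, mono_mul_mem_iff_of_isAddUnit hu] at hmem

theorem isBinomial_locComponent (hI : IsBinomial I) : IsBinomial (locComponent I P w ρ) := by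
  refine (hI.locIdeal.sup (isBinomial_characterIdeal ρ)).sup ?_
  rw [map_cogeneratedMonomialIdeal]
  exact isBinomial_span_mono _

/-- The functional of `I_P` at `w` also kills the added generators: the character binomials because
the scalars along the stabilizer are those of `ρ`, the monomials because no multiple of them reaches
the class of `w`. -/
theorem mono_notMem_locComponent (hI : IsBinomial I) (hρ : IsCharacterAt I P w ρ) :
    mono k (P.toLoc w) ∉ locComponent I P w ρ := by
  intro hmem
  obtain ⟨φ, h1, h2, h3⟩ := hI.locIdeal.exists_functional hρ.mono_notMem
  have hφ : ∀ {u : P.Loc} {c : k}, mono k u - c • mono k (P.toLoc w) ∈ locIdeal I P →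
      φ (mono k u) = c := by
    intro u c h
    have := h1 _ h
    rwa [map_sub, map_smul, h2, smul_eq_mul, mul_one, sub_eq_zero] at this
  have kill : locComponent I P w ρ ≤ (Ideal.span
      (locIdeal I P ∪ {f | ∃ (g : stabilizer I P w) (v : P.Loc),
        f = mono k (((g : AddUnits P.Loc) : P.Loc) + v)
          - ((ρ (Multiplicative.ofAdd g) : kˣ) : k) • mono k v} ∪
        (fun u : P.Loc => mono k u) '' (P.toLoc '' {u | ¬ LocLE I P (P.toLoc u) (P.toLoc w)}))) := by
    rw [Ideal.span_union, Ideal.span_union, Ideal.span_eq, ← map_cogeneratedMonomialIdeal]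
    exact le_rfl
  have h0 : mono k (P.toLoc w) ∈ LinearMap.ker φ := by
    refine mem_of_mem_ideal_span _ ?_ (kill hmem)
    rintro a f ((hf | ⟨g, v, rfl⟩) | ⟨_, ⟨u, hu, rfl⟩, rfl⟩)
    · exact h1 _ ((locIdeal I P).mul_mem_left _ hf)
    · rw [mono_mul_binomial, LinearMap.mem_ker, map_sub, map_smul, add_left_comm, smul_eq_mul,
        sub_eq_zero]
      by_cases h : inducedCon (locIdeal I P) (a + v) (P.toLoc w)
      · obtain ⟨c, hc⟩ := h
        rw [hφ hc]
        apply hφ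
        have e1 := (locIdeal I P).mul_mem_left (mono k ((g : AddUnits P.Loc) : P.Loc)) hc
        have e2 := (locIdeal I P).add_mem e1 (smul_mem_ideal (c : k) (hρ.sub_mem g))
        rwa [mono_mul_binomial, smul_sub, smul_smul, sub_add_sub_cancel, mul_comm] at e2
      · rw [h3 _ h, mul_zero]
        refine h3 _ fun h' => h ?_
        have e1 := con_add_left h' ((-(g : AddUnits P.Loc) : AddUnits P.Loc) : P.Loc)
        rw [AddUnits.neg_add_cancel_left] at e1
        exact (inducedCon _).trans e1
          (mem_stabilizer_iff.1 ((stabilizer I P w).neg_mem g.2))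
    · rw [← mono_add, LinearMap.mem_ker]
      refine h3 _ fun h => hu ?_
      exact LocLE.of_add (y := a) (by rw [add_comm]; exact LocLE.of_con h)
  rw [LinearMap.mem_ker, h2] at h0
  exact one_ne_zero h0

theorem mono_mem_locComponent_iff (hI : IsBinomial I) (hρ : IsCharacterAt I P w ρ) {x : P.Loc} :
    mono k x ∈ locComponent I P w ρ ↔ ¬ LocLE I P x (P.toLoc w) := by
  refine ⟨?_, mono_mem_locComponent⟩
  rintro h ⟨u, hu⟩
  refine mono_notMem_locComponent hI hρ ?_
  exact (mono_mem_iff_of_inducedCon (inducedCon_mono locIdeal_le_locComponent hu)).1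
    (mono_add_mem h u)

/-- All generators are monomials or homogeneous for `componentCon`, so a binomial joining two
different classes has both terms in the ideal. Both then fail to precede `w`, and `componentCon`
joins them after all. -/
theorem inducedCon_locComponent (hI : IsBinomial I) (hρ : IsCharacterAt I P w ρ) :
    inducedCon (locComponent I P w ρ) = componentCon I P w := by
  obtain ⟨T, hT, hTI⟩ := hI.locIdeal (P := P)
  have hspan : locComponent I P w ρ = Ideal.span
      (T ∪ {f | ∃ (g : stabilizer I P w) (v : P.Loc),
        f = mono k (((g : AddUnits P.Loc) : P.Loc) + v)
          - ((ρ (Multiplicative.ofAdd g) : kˣ) : k) • mono k v} ∪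
        (fun u : P.Loc => mono k u) '' (P.toLoc '' {u | ¬ LocLE I P (P.toLoc u) (P.toLoc w)})) := by
    rw [Ideal.span_union, Ideal.span_union, ← hTI, ← map_cogeneratedMonomialIdeal]
    rfl
  apply le_antisymm
  · have key : ∀ x y : P.Loc, inducedCon (locComponent I P w ρ) x y →
        ¬ componentCon I P w x y → mono k x ∈ locComponent I P w ρ := by
      rintro x y ⟨c, hc⟩ hxy
      rw [hspan] at hc ⊢
      refine mono_mem_span_of_not_con (componentCon I P w) ?_ hc hxy
      rintro f ((hf | ⟨g, v, rfl⟩) | ⟨_, ⟨u, hu, rfl⟩, rfl⟩)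
      · obtain ⟨p, q, r, rfl⟩ := hT f hf
        refine ⟨p, q, r, rfl, or_iff_not_imp_left.2 fun hr => Or.inr ⟨0, zero_mem _, ?_⟩⟩
        rw [AddUnits.val_zero, zero_add]
        exact ⟨Units.mk0 r hr, hTI ▸ Ideal.subset_span hf⟩
      · exact ⟨_, _, _, rfl, Or.inr (Or.inr ⟨g, g.2, (inducedCon _).refl _⟩)⟩
      · exact ⟨P.toLoc u, P.toLoc u, 0, by simp, Or.inl rfl⟩
    intro x y hxy
    by_contra hn
    have hx := key x y hxy hn
    have hy := key y x ((inducedCon _).symm hxy) fun h => hn ((componentCon I P w).symm h)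
    rw [mono_mem_locComponent_iff hI hρ] at hx hy
    exact hn (Or.inl ⟨hx, hy⟩)
  · rintro x y (⟨hx, hy⟩ | ⟨h, hh, hxy⟩)
    · exact inducedCon_of_mono_mem (mono_mem_locComponent hx) (mono_mem_locComponent hy)
    · refine (inducedCon _).trans (inducedCon_mono locIdeal_le_locComponent hxy) ?_
      exact ⟨ρ (Multiplicative.ofAdd ⟨h, hh⟩),
        characterIdeal_le_locComponent (Ideal.subset_span ⟨⟨h, hh⟩, y, rfl⟩)⟩

/-- Elements preceding `w` are joined by the component only along the stabilizer of `w`. -/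
theorem exists_stabilizer_of_inducedCon_locComponent (hI : IsBinomial I)
    (hρ : IsCharacterAt I P w ρ) {x y : P.Loc} (hxy : inducedCon (locComponent I P w ρ) x y)
    (hy : LocLE I P y (P.toLoc w)) :
    ∃ h ∈ stabilizer I P w, inducedCon (locIdeal I P) x ((h : P.Loc) + y) := by
  rw [inducedCon_locComponent hI hρ] at hxy
  exact (componentCon_iff.1 hxy).resolve_left fun h => h.2 hy

theorem mono_mem_component_iff (hI : IsBinomial I) (hρ : IsCharacterAt I P w ρ) {q : Q} :
    mono k q ∈ component I P w ρ ↔ ¬ LocLE I P (P.toLoc q) (P.toLoc w) := by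
  rw [component_eq, Ideal.mem_comap, locMap_mono, mono_mem_locComponent_iff hI hρ]

theorem inducedCon_component_iff {p q : Q} : inducedCon (component I P w ρ) p q ↔
    inducedCon (locComponent I P w ρ) (P.toLoc p) (P.toLoc q) :=
  inducedCon_comap_iff

theorem isBinomial_component (hI : IsBinomial I) : IsBinomial (component I P w ρ) :=
  (isBinomial_locComponent hI).comap_locMap

theorem mono_self_notMem_component (hI : IsBinomial I) (hρ : IsCharacterAt I P w ρ) :
    mono k w ∉ component I P w ρ := by
  rw [mono_mem_component_iff hI hρ, not_not]
  exact LocLE.refl _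

theorem component_ne_top (hI : IsBinomial I) (hρ : IsCharacterAt I P w ρ) :
    component I P w ρ ≠ ⊤ := fun h =>
  mono_self_notMem_component hI hρ (h ▸ Submodule.mem_top)

theorem mono_add_mem_component (hI : IsBinomial I) (hρ : IsCharacterAt I P w ρ) {p : Q}
    (hp : p ∈ P.carrier) : mono k (p + w) ∈ component I P w ρ := by
  rw [mono_mem_component_iff hI hρ, map_add]
  exact hρ.not_locLE fun h => P.isAddUnit_toLoc_iff.1 h hp

theorem inducedCon_component_of_add {s : Q} (hs : s ∈ P.face) {a b : Q}
    (h : inducedCon (component I P w ρ) (s + a) (s + b)) :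
    inducedCon (component I P w ρ) a b := by
  rw [inducedCon_component_iff] at h ⊢
  rw [map_add P.toLoc, map_add P.toLoc, add_comm (P.toLoc s), add_comm (P.toLoc s)] at h
  exact (con_add_isAddUnit_right_iff _ (P.isAddUnit_toLoc_of_mem_face hs)).1 h

theorem isCancellative_of_mem_face {s : Q} (hs : s ∈ P.face) :
    IsCancellative (s : (inducedCon (component I P w ρ)).Quotient) := by
  intro a b h
  induction a using AddCon.induction_on with
  | H a =>
  induction b using AddCon.induction_on with
  | H b =>
  rw [← AddCon.coe_add, ← AddCon.coe_add, AddCon.eq] at h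
  exact (AddCon.eq _).2 (inducedCon_component_of_add hs h)

/-- It suffices that `J` contains no new monomial: then the functionals of `J` test membership in
the component, as the congruences agree. -/
theorem isMaximalForCon_component (hI : IsBinomial I) (hρ : IsCharacterAt I P w ρ) :
    IsMaximalForCon (component I P w ρ) := by
  refine ⟨⟨isBinomial_component hI, component_ne_top hI hρ, rfl⟩, ?_⟩
  rintro J ⟨hJ, hJtop, hJcon⟩ hle f hf
  have key : ∀ u, mono k u ∉ component I P w ρ → mono k u ∉ J := by
    intro u hu huJ
    by_cases hn : ∃ n, mono k n ∈ component I P w ρ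
    · obtain ⟨n, hn⟩ := hn
      have hc : inducedCon J u n := inducedCon_of_mono_mem huJ (hle hn)
      rw [hJcon] at hc
      exact hu ((mono_mem_iff_of_inducedCon hc).2 hn)
    -- Without monomials in the component `P` is empty and everything is cancellative. From `t^u ∈
    -- J` follows `u + u ~ u`, hence `u ~ 0` and `1 ∈ J`.
    · have hface : u ∈ P.face := fun hp => hn ⟨_, mono_add_mem_component hI hρ hp⟩
      have hc : inducedCon J (u + u) (u + 0) :=
        inducedCon_of_mono_mem (mono_add_mem huJ u) (by rwa [add_zero])
      rw [hJcon] at hc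
      have h0 := inducedCon_component_of_add hface hc
      rw [← hJcon] at h0
      exact hJtop ((Ideal.eq_top_iff_one J).2 ((mono_mem_iff_of_inducedCon h0).1 huJ))
  refine binomialPart_le _ (mem_binomialPart_of_functionals fun u hu => ?_)
  obtain ⟨φ, h1, h2, h3⟩ := hJ.exists_functional (key u hu)
  exact ⟨φ, fun x hx => h1 x (hle hx), h2 ▸ one_ne_zero, fun v hv => h3 v (hJcon ▸ hv), h1 f hf⟩

/-- The ideals `W : t^{np}` stabilize. If no `t^{np}` lies in `W`, some multiple of the one at the
stable index is a unit translate of `w` modulo `I_P`. One more `p` puts it into `W`, so by stability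
it was already there, a contradiction. -/
theorem exists_nsmul_mono_mem_component [AddMonoid.FG Q] (hI : IsBinomial I)
    (hρ : IsCharacterAt I P w ρ) {p : Q} (hp : p ∈ P.carrier) :
    ∃ n : ℕ, mono k (n • p) ∈ component I P w ρ := by
  by_contra! hn
  have : IsNoetherianRing (AddMonoidAlgebra k Q) := Algebra.FiniteType.isNoetherianRing k _
  set W := component I P w ρ with hW
  let F : ℕ →o Ideal (AddMonoidAlgebra k Q) :=
    ⟨fun n => W.colon {mono k (n • p)}, monotone_nat_of_le_succ fun n f hf => by
      rw [Submodule.mem_colon_singleton, smul_eq_mul] at hf ⊢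
      rw [succ_nsmul, mono_add, ← mul_assoc]
      exact W.mul_mem_right _ hf⟩
  obtain ⟨n, hF⟩ := monotone_stabilizes_iff_noetherian.2 this F
  have hstab : ∀ f, mono k ((n + 1) • p) * f ∈ W → mono k (n • p) * f ∈ W := by
    intro f hf
    have h1 : f ∈ F (n + 1) := Submodule.mem_colon_singleton.2 (by rwa [smul_eq_mul, mul_comm])
    rw [← hF (n + 1) n.le_succ] at h1
    have := Submodule.mem_colon_singleton.1 h1
    rwa [smul_eq_mul, mul_comm] at this
  obtain ⟨u, hu⟩ := not_not.1 ((mono_mem_component_iff hI hρ).not.1 (hn n))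
  obtain ⟨a, s, hs, ha⟩ := P.toLoc_surj u
  have hcon : inducedCon (locIdeal I P) (P.toLoc (n • p + a)) (P.toLoc w + P.toLoc s) := by
    have := con_add_right hu (P.toLoc s)
    rwa [add_assoc, ha, ← map_add] at this
  have hunit := P.isAddUnit_toLoc_of_mem_face hs
  have h1 : mono k ((n + 1) • p) * mono k a ∈ W := by
    rw [← mono_add, mono_mem_component_iff hI hρ, succ_nsmul', add_assoc, map_add]
    intro h
    have h2 : LocLE I P (P.toLoc p + P.toLoc w + P.toLoc s) (P.toLoc w) := by
      rw [add_assoc]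
      exact (LocLE.of_con (con_add_left ((inducedCon _).symm hcon) _)).trans h
    rw [locLE_add_unit_iff hunit] at h2
    exact hρ.not_locLE (fun h => P.isAddUnit_toLoc_iff.1 h hp) h2
  have h2 := hstab _ h1
  rw [← mono_add, mono_mem_component_iff hI hρ] at h2
  apply h2
  refine (LocLE.of_con hcon).trans ?_
  rw [locLE_add_unit_iff hunit]
  exact LocLE.refl _

theorem isMesoprimaryConFor_component [AddMonoid.FG Q] (hI : IsBinomial I)
    (hρ : IsCharacterAt I P w ρ) : IsMesoprimaryConFor (inducedCon (component I P w ρ)) P := by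
  have hnil : ∀ {q : Q}, mono k q ∈ component I P w ρ →
      IsNil (q : (inducedCon (component I P w ρ)).Quotient) := fun hq =>
    isNil_mk_of_mono_mem rfl hq (mono_self_notMem_component hI hρ)
  have hP : ∀ p ∈ P.carrier,
      IsNilpotentElt (p : (inducedCon (component I P w ρ)).Quotient) := by
    intro p hp
    obtain ⟨n, hn⟩ := exists_nsmul_mono_mem_component hI hρ hp
    exact ⟨n, hnil hn⟩
  have hface : ∀ {q : Q}, IsCancellative (q : (inducedCon (component I P w ρ)).Quotient) →
      q ∈ P.face := fun hq hp => hq.not_isNilpotentElt (hP _ hp)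
  refine ⟨⟨fun x => ?_, fun x a b ha hb hab hn => ?_⟩, ?_⟩
  · induction x using AddCon.induction_on with
    | H x =>
    by_cases hx : x ∈ P.carrier
    · exact Or.inl (hP x hx)
    · exact Or.inr (isCancellative_of_mem_face hx)
  · induction x using AddCon.induction_on with
    | H x =>
    induction a using AddCon.induction_on with
    | H a =>
    induction b using AddCon.induction_on with
    | H b =>
    have ha' := P.isAddUnit_toLoc_of_mem_face (hface ha)
    have hb' := P.isAddUnit_toLoc_of_mem_face (hface hb)
    rw [← AddCon.coe_add] at hab hn
    rw [← AddCon.coe_add, AddCon.eq, inducedCon_component_iff] at hab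
    have hle : LocLE I P (P.toLoc (x + a)) (P.toLoc w) := by
      by_contra h
      exact hn (hnil ((mono_mem_component_iff hI hρ).2 h))
    obtain ⟨h, hh, hc⟩ :=
      exists_stabilizer_of_inducedCon_locComponent hI hρ ((inducedCon _).symm hab) hle
    rw [map_add, locLE_add_unit_iff ha'] at hle
    obtain ⟨y, hy⟩ := hle
    rw [AddCon.eq, inducedCon_component_iff, inducedCon_locComponent hI hρ, componentCon_iff]
    obtain ⟨g, hg⟩ := ha'
    obtain ⟨g', hg'⟩ := hb'
    -- Since `x + y ~ w`, adding `y` transports the relation between `x + a` and `x + b` to `w`,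
    -- where the units `a` and `b` can be compared through the stabilizer.
    have h1 : inducedCon (locIdeal I P) (P.toLoc b + P.toLoc w)
        (((h + g : AddUnits P.Loc) : P.Loc) + P.toLoc w) := by
      have e1 := con_add_right hc y
      have e2 := con_add_left hy (P.toLoc b)
      have e3 := con_add_left hy ((h : P.Loc) + P.toLoc a)
      refine (inducedCon _).trans ((inducedCon _).symm e2) ((inducedCon _).trans ?_
        (by rw [AddUnits.val_add, hg]; exact e3))
      convert e1 using 1
      · rw [map_add]; abel
      · rw [map_add]; abel
    obtain ⟨r, hr⟩ := exists_stabilizer_of_con (fun x hx => hρ.not_locLE hx) _ _ h1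
    refine Or.inr ⟨-(r + h), (stabilizer I P w).neg_mem
      ((stabilizer I P w).add_mem r.2 hh), ?_⟩
    rw [hr, ← hg]
    have : (g : P.Loc) = ((-(r + h) : AddUnits P.Loc) : P.Loc)
        + (((r : AddUnits P.Loc) : P.Loc) + ((h + g : AddUnits P.Loc) : P.Loc)) := by
      rw [← AddUnits.val_add, ← AddUnits.val_add]
      congr 1
      abel
    rw [← this]
    exact (inducedCon _).refl _
  · ext q
    refine ⟨hP q, fun hq => ?_⟩
    by_contra h
    exact (isCancellative_of_mem_face (P := P) h).not_isNilpotentElt hq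

theorem isMesoprimaryFor_component [AddMonoid.FG Q] (hI : IsBinomial I)
    (hρ : IsCharacterAt I P w ρ) : IsMesoprimaryFor (component I P w ρ) P :=
  ⟨isMaximalForCon_component hI hρ, isMesoprimaryConFor_component hI hρ⟩

theorem isAddUnit_mk {M : Type*} [AddCommMonoid M] (c : AddCon M) {x : M} (hx : IsAddUnit x) :
    IsAddUnit (x : c.Quotient) :=
  hx.map c.mk'

/-- Nonunits move `w` out of its order ideal, so `w` is in the socle. Any socle element precedes
`w`, and the element taking it to `w` is a unit because `w` is not nil. -/
theorem isCoprincipal_component [AddMonoid.FG Q] (hI : IsBinomial I)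
    (hρ : IsCharacterAt I P w ρ) : IsCoprincipal (component I P w ρ) := by
  refine ⟨isMaximalForCon_component hI hρ, P, isMesoprimaryConFor_component hI hρ, ?_⟩
  set c := inducedCon (component I P w ρ) with hc
  have hcon : locCon c P = inducedCon (locComponent I P w ρ) := by
    rw [hc, locCon_inducedCon, locIdeal_component]
  have hnil : ∀ {x : P.Loc}, mono k x ∈ locComponent I P w ρ → IsNil (x : LocQuot c P) :=
    fun hx => isNil_mk_of_mono_mem hcon hx (mono_notMem_locComponent hI hρ)
  -- If `w ∈ P`, a nil `w` would satisfy `w + w ~ w`, although only `t^{w+w}` lies in the ideal.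
  -- Otherwise `w` is a unit, and a unit is never nil, even in the one-element quotient.
  have hwnil : ¬ IsNil ((P.toLoc w : P.Loc) : LocQuot c P) := by
    by_cases hw : w ∈ P.carrier
    · intro h
      have h1 := h.2 ((P.toLoc w : P.Loc) : LocQuot c P)
      rw [← AddCon.coe_add, AddCon.eq, hcon] at h1
      refine mono_notMem_locComponent hI hρ ((mono_mem_iff_of_inducedCon h1).1 ?_)
      exact mono_mem_locComponent (hρ.not_locLE fun h => P.isAddUnit_toLoc_iff.1 h hw)
    · exact not_isNil_of_isCancellative (isCancellative_of_isAddUnit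
        (isAddUnit_mk _ (P.isAddUnit_toLoc_of_mem_face hw)))
  have hws : ((P.toLoc w : P.Loc) : LocQuot c P) ∈ socle (LocQuot c P) := by
    refine ⟨hwnil, fun a ha => ?_⟩
    induction a using AddCon.induction_on with
    | H a =>
    rw [← AddCon.coe_add]
    refine hnil (mono_mem_locComponent ?_)
    rw [add_comm]
    exact hρ.not_locLE fun h => ha (isAddUnit_mk _ h)
  have hgreen : ∀ s ∈ socle (LocQuot c P), GreenLE s ((P.toLoc w : P.Loc) : LocQuot c P) ∧
      GreenLE ((P.toLoc w : P.Loc) : LocQuot c P) s := by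
    rintro s ⟨hs1, hs2⟩
    induction s using AddCon.induction_on with
    | H x =>
    have hle : LocLE I P x (P.toLoc w) := by
      by_contra h
      exact hs1 (hnil (mono_mem_locComponent h))
    obtain ⟨u, hu⟩ := hle
    have e : (x : LocQuot c P) + (u : LocQuot c P) = ((P.toLoc w : P.Loc) : LocQuot c P) := by
      rw [← AddCon.coe_add, AddCon.eq, hcon]
      exact inducedCon_mono locIdeal_le_locComponent hu
    have hunit : IsAddUnit (u : LocQuot c P) := by
      by_contra h
      exact hwnil (e ▸ hs2 _ h)
    obtain ⟨v, hv⟩ := hunit.exists_neg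
    refine ⟨⟨_, e⟩, v, ?_⟩
    rw [← e, add_assoc, hv, add_zero]
  refine ⟨⟨_, hws⟩, fun s hs s' hs' => ⟨?_, ?_⟩⟩
  · exact (hgreen s hs).1.trans (hgreen s' hs').2
  · exact (hgreen s' hs').1.trans (hgreen s hs).2

end Component

/-! ### Socle monomials and change of cogenerator -/

section Socle

variable {k : Type*} [Field k] {Q : Type*} [AddCommMonoid Q] {P : MonoidPrime Q}
  {I : Ideal (AddMonoidAlgebra k Q)} {w : Q} {ρ : Multiplicative (stabilizer I P w) →* kˣ}

theorem MonoidPrime.ext_carrier {P P' : MonoidPrime Q} (h : P.carrier = P'.carrier) : P = P' := by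
  cases P; cases P'; cases h; rfl

theorem IsMesoprimaryConFor.unique {c : AddCon Q} {P P' : MonoidPrime Q}
    (h : IsMesoprimaryConFor c P) (h₂ : IsMesoprimaryConFor c P') : P = P' :=
  MonoidPrime.ext_carrier (h.2.trans h₂.2.symm)

/-- The monomials in the socle of a component are the translates of its cogenerator by units. -/
theorem exists_unit_of_inMonomialSocle (hI : IsBinomial I) (hρ : IsCharacterAt I P w ρ) {q : Q}
    (hq : InMonomialSocle (component I P w ρ) P q) :
    ∃ u, IsAddUnit u ∧ inducedCon (locIdeal I P) (P.toLoc q + u) (P.toLoc w) := by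
  obtain ⟨h1, h2⟩ := hq
  rw [locIdeal_component, mono_mem_locComponent_iff hI hρ, not_not] at h1
  obtain ⟨u, hu⟩ := h1
  refine ⟨u, ?_, hu⟩
  by_contra hn
  obtain ⟨p, hp, g, hg, rfl⟩ := P.exists_of_not_isAddUnit hn
  have h3 := h2 p hp
  rw [locIdeal_component] at h3
  refine mono_notMem_locComponent hI hρ ((mono_mem_iff_of_inducedCon
    (inducedCon_mono locIdeal_le_locComponent hu)).1 ?_)
  have := mono_add_mem h3 g
  rwa [map_add, add_comm (P.toLoc p), add_assoc] at this

theorem IsWitness.of_con {u : P.Loc} (hu : IsAddUnit u) {q : Q}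
    (hc : inducedCon (locIdeal I P) (P.toLoc q + u) (P.toLoc w)) (hw : IsWitness I P w) :
    IsWitness I P q := by
  obtain ⟨h1, h2, h3⟩ := hw
  have e : toLocQuot (inducedCon I) P q + (u : LocQuot (inducedCon I) P)
      = toLocQuot (inducedCon I) P w := by
    rw [toLocQuot_apply, toLocQuot_apply, ← AddCon.coe_add, mk_eq_mk_iff]
    exact hc
  obtain ⟨v, hv⟩ := (isAddUnit_mk (locCon (inducedCon I) P) hu).exists_neg
  have e' : toLocQuot (inducedCon I) P w + v = toLocQuot (inducedCon I) P q := by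
    rw [← e, add_assoc, hv, add_zero]
  refine ⟨fun h => h1 ((mono_mem_iff_of_inducedCon hc).1 (mono_add_mem h u)),
    fun h => h2 (e ▸ h.add _), fun p hp => ?_⟩
  obtain ⟨b, hb, hpb⟩ := h3 p hp
  refine ⟨b + v, fun h => hb ?_, ?_⟩
  · rw [← e, ← h, add_assoc, add_comm v, hv, add_zero]
  · rw [← add_assoc, hpb, add_assoc, e']

theorem colon_mono_eq_of_con {J : Ideal (AddMonoidAlgebra k P.Loc)} {x y u : P.Loc}
    (hu : IsAddUnit u) (hc : inducedCon J (x + u) y) :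
    J.colon {mono k x} = J.colon {mono k y} := by
  obtain ⟨c, hc⟩ := hc
  ext f
  rw [Submodule.mem_colon_singleton, Submodule.mem_colon_singleton, smul_eq_mul, smul_eq_mul,
    ← mono_mul_mem_iff_of_isAddUnit hu, ← smul_mem_ideal_iff c.ne_zero (f := f * mono k y)]
  have e : mono k u * (f * mono k x) = f * mono k (x + u) := by rw [mono_add]; ring
  have h := J.mul_mem_left f hc
  rw [mul_sub, mul_smul_comm] at h
  rw [e]
  exact ⟨fun hx => by simpa using J.sub_mem hx h, fun hy => by simpa using J.add_mem h hy⟩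

/-- A binomial ideal and its component have the same mesoprime at each socle monomial of the
component. -/
theorem mesoprimeAt_eq_of_inMonomialSocle (hI : IsBinomial I) (hρ : IsCharacterAt I P w ρ) {q : Q}
    (hq : InMonomialSocle (component I P w ρ) P q) :
    mesoprimeAt I P q = mesoprimeAt (component I P w ρ) P q := by
  obtain ⟨u, hu, hc⟩ := exists_unit_of_inMonomialSocle hI hρ hq
  have h1 : localMesoprimeAt I P q = characterIdeal ρ ⊔ primeMonomialIdeal k P := by
    rw [localMesoprimeAt, colon_mono_eq_of_con hu hc]
    exact hρ.symm
  have h2 : localMesoprimeAt (component I P w ρ) P q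
      = characterIdeal ρ ⊔ primeMonomialIdeal k P := by
    rw [localMesoprimeAt, locIdeal_component,
      colon_mono_eq_of_con hu (inducedCon_mono locIdeal_le_locComponent hc)]
    refine colon_sup_eq_characterIdeal_sup ρ (isBinomial_locComponent hI)
      (mono_notMem_locComponent hI hρ) (fun g => locIdeal_le_locComponent (hρ.sub_mem g)) ?_
    -- The component may join more than `I_P`, but below `w` only along the stabilizer, so the
    -- argument for `I_P` still applies.
    intro x g hxg
    have hle : LocLE I P ((g : P.Loc) + P.toLoc w) (P.toLoc w) := by
      rw [add_comm, locLE_add_unit_iff g.isAddUnit]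
      exact LocLE.refl _
    obtain ⟨h, hh, hx⟩ := exists_stabilizer_of_inducedCon_locComponent hI hρ hxg hle
    rw [← add_assoc, ← AddUnits.val_add] at hx
    obtain ⟨r, hr⟩ := exists_stabilizer_of_con (fun x hx => hρ.not_locLE hx) _ _ hx
    refine ⟨r + ⟨h, hh⟩, ?_⟩
    rw [hr]
    simp [add_assoc]
  rw [mesoprimeAt, mesoprimeAt, h1, h2]

theorem stabilizer_eq_of_con {w' : Q} {u : P.Loc} (hu : IsAddUnit u)
    (hc : inducedCon (locIdeal I P) (P.toLoc w + u) (P.toLoc w')) :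
    stabilizer I P w = stabilizer I P w' := by
  ext g
  rw [mem_stabilizer_iff, mem_stabilizer_iff, ← con_add_isAddUnit_right_iff _ hu, add_assoc]
  have h1 := con_add_left hc (g : P.Loc)
  exact ⟨fun h => (inducedCon _).trans ((inducedCon _).symm h1) ((inducedCon _).trans h hc),
    fun h => (inducedCon _).trans h1 ((inducedCon _).trans h ((inducedCon _).symm hc))⟩

/-- Passing from `g + w + u` to `w'` through `w + u` or through `g + w'` gives the same scalar;
cancelling the common factor `c` leaves equal characters. -/
theorem characterIdeal_le_of_con {w' : Q} {ρ' : Multiplicative (stabilizer I P w') →* kˣ}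
    (hρ : IsCharacterAt I P w ρ) (hρ' : IsCharacterAt I P w' ρ') {u : P.Loc} (hu : IsAddUnit u)
    (hc : inducedCon (locIdeal I P) (P.toLoc w + u) (P.toLoc w')) :
    characterIdeal ρ ≤ characterIdeal ρ' := by
  refine Ideal.span_le.2 ?_
  rintro _ ⟨g, v, rfl⟩
  have hg : (g : AddUnits P.Loc) ∈ stabilizer I P w' := stabilizer_eq_of_con hu hc ▸ g.2
  refine Ideal.subset_span ⟨⟨g, hg⟩, v, ?_⟩
  congr 2
  have h1 := (locIdeal I P).mul_mem_left (mono k u) (hρ.sub_mem g)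
  rw [mono_mul_binomial] at h1
  obtain ⟨c, hc⟩ := hc
  have h2 := (locIdeal I P).mul_mem_left (mono k ((g : AddUnits P.Loc) : P.Loc)) hc
  rw [mono_mul_binomial] at h2
  have h3 := hρ'.sub_mem ⟨g, hg⟩
  have h4 := (locIdeal I P).add_mem h2 (smul_mem_ideal (c : k) h3)
  rw [smul_sub, sub_add_sub_cancel, smul_smul] at h4
  have h5 := (locIdeal I P).add_mem h1
    (smul_mem_ideal (ρ (Multiplicative.ofAdd g) : k)
      (by rw [add_comm (P.toLoc w)] at hc; exact hc))
  rw [smul_sub, sub_add_sub_cancel, smul_smul] at h5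
  have e : u + (((g : AddUnits P.Loc) : P.Loc) + P.toLoc w)
      = ((g : AddUnits P.Loc) : P.Loc) + (P.toLoc w + u) := by
    rw [add_left_comm, add_comm u]
  rw [e] at h5
  have h6 := scalar_unique hρ'.mono_notMem h5 h4
  rw [mul_comm] at h6
  exact mul_left_cancel₀ c.ne_zero h6

/-- Translating the cogenerator by a unit does not change the component. -/
theorem component_eq_of_con {w' : Q} {ρ' : Multiplicative (stabilizer I P w') →* kˣ}
    (hρ : IsCharacterAt I P w ρ) (hρ' : IsCharacterAt I P w' ρ') {u : P.Loc} (hu : IsAddUnit u)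
    (hc : inducedCon (locIdeal I P) (P.toLoc w + u) (P.toLoc w')) :
    component I P w ρ = component I P w' ρ' := by
  obtain ⟨v, hv⟩ := hu.exists_neg
  have hv' : IsAddUnit v := ⟨⟨v, u, by rw [add_comm]; exact hv, hv⟩, rfl⟩
  have hc' : inducedCon (locIdeal I P) (P.toLoc w' + v) (P.toLoc w) := by
    have := con_add_right ((inducedCon _).symm hc) v
    rwa [add_assoc, hv, add_zero] at this
  have hchar : characterIdeal ρ = characterIdeal ρ' :=
    le_antisymm (characterIdeal_le_of_con hρ hρ' hu hc) (characterIdeal_le_of_con hρ' hρ hv' hc')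
  have hord : orderIdeal (inducedCon I) P w = orderIdeal (inducedCon I) P w' := by
    ext a
    rw [mem_orderIdeal_iff, mem_orderIdeal_iff]
    exact ⟨fun h => h.trans ⟨u, hc⟩, fun h => h.trans ⟨v, hc'⟩⟩
  rw [component, component, hchar, cogeneratedMonomialIdeal, cogeneratedMonomialIdeal, hord]

end Socle

/-! ### Socle elements, witnesses and the finite intersection -/

section Intersection

variable {k : Type*} [Field k] {Q : Type*} [AddCommMonoid Q]

/-- The elements of `k[Q]` whose image in `k[Q]_P / I_P` is annihilated by `m_P`. -/
def socleIdeal (I : Ideal (AddMonoidAlgebra k Q)) (P : MonoidPrime Q) :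
    Ideal (AddMonoidAlgebra k Q) where
  carrier := {f | ∀ p ∈ P.carrier, locMap k P (mono k p * f) ∈ locIdeal I P}
  add_mem' := fun ha hb p hp => by
    rw [mul_add, map_add]; exact (locIdeal I P).add_mem (ha p hp) (hb p hp)
  zero_mem' := fun p _ => by simp
  smul_mem' := fun c f hf p hp => by
    rw [smul_eq_mul, mul_left_comm, map_mul]
    exact (locIdeal I P).mul_mem_left _ (hf p hp)

variable {P : MonoidPrime Q} {I : Ideal (AddMonoidAlgebra k Q)}

theorem exists_locLE_minimal (I : Ideal (AddMonoidAlgebra k Q)) (P : MonoidPrime Q) {s : Finset Q}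
    (hs : s.Nonempty) : ∃ w ∈ s, ∀ v ∈ s, LocLE I P (P.toLoc v) (P.toLoc w) →
      LocLE I P (P.toLoc w) (P.toLoc v) := by
  let _ : Preorder Q :=
    { le := fun v w => LocLE I P (P.toLoc v) (P.toLoc w)
      le_refl := fun v => LocLE.refl _
      le_trans := fun _ _ _ h h' => LocLE.trans h h' }
  obtain ⟨w, hw⟩ := s.exists_minimal hs
  exact ⟨w, hw.1, fun v hv h => hw.2 hv h⟩

/-- A socle element outside of `I_P` is excluded by the component cogenerated by one of the
monomials in its normal form. If a set `T` generates the socle, this monomial is a translate of one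
that occurs in an element of `T`. -/
theorem exists_component_notMem (hI : IsBinomial I) {f : AddMonoidAlgebra k Q}
    (hf : locMap k P f ∉ locIdeal I P) (hsoc : f ∈ socleIdeal I P)
    {T : Set (AddMonoidAlgebra k Q)} (hT : socleIdeal I P = Ideal.span T) :
    ∃ (w : Q) (ρ : Multiplicative (stabilizer I P w) →* kˣ), IsWitness I P w ∧
      IsCharacterAt I P w ρ ∧ f ∉ component I P w ρ ∧
      ∃ e ∈ T, ∃ τ ∈ e.coeff.support, ∃ s ∈ P.face,
        inducedCon (locIdeal I P) (P.toLoc τ + P.toLoc s) (P.toLoc w) := by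
  obtain ⟨g, hfg, hg1, hg2⟩ := exists_normalForm ((locIdeal I P).comap (locMap k P)) f
  replace hfg : locMap k P f - locMap k P g ∈ locIdeal I P := by
    rw [← map_sub]; exact Ideal.mem_comap.1 (binomialPart_le _ hfg)
  replace hg1 : ∀ u ∈ g.coeff.support, mono k (P.toLoc u) ∉ locIdeal I P := by
    intro u hu h
    exact hg1 u hu (by rwa [Ideal.mem_comap, locMap_mono])
  replace hg2 : ∀ u ∈ g.coeff.support, ∀ v ∈ g.coeff.support,
      inducedCon (locIdeal I P) (P.toLoc u) (P.toLoc v) → u = v := fun u hu v hv h =>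
    hg2 u hu v hv (inducedCon_comap_iff.2 h)
  have hg0 : g ≠ 0 := by
    rintro rfl
    rw [map_zero, sub_zero] at hfg
    exact hf hfg
  have hsupp : g.coeff.support.Nonempty := by
    rw [Finsupp.support_nonempty_iff]
    simpa using hg0
  obtain ⟨w, hw, hmin⟩ := exists_locLE_minimal I P hsupp
  have hgw : g.coeff w ≠ 0 := Finsupp.mem_support_iff.1 hw
  have hann : ∀ x : P.Loc, ¬ IsAddUnit x → mono k x * locMap k P g ∈ locIdeal I P := by
    intro x hx
    obtain ⟨p, hp, y, hy, rfl⟩ := P.exists_of_not_isAddUnit hx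
    have h1 := hsoc p hp
    rw [map_mul, locMap_mono] at h1
    have h2 := (locIdeal I P).sub_mem h1 ((locIdeal I P).mul_mem_left (mono k (P.toLoc p)) hfg)
    rw [← mul_sub, sub_sub_cancel] at h2
    rw [add_comm, mono_add, mul_assoc]
    exact (locIdeal I P).mul_mem_left _ h2
  -- Otherwise the functional of `I_P` at `x + w` would see only the term of `w` in `t^x g`, which
  -- lies in `I_P`.
  have hpartner : ∀ x : P.Loc, ¬ IsAddUnit x → mono k (x + P.toLoc w) ∉ locIdeal I P →
      ∃ v ∈ g.coeff.support, v ≠ w ∧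
        inducedCon (locIdeal I P) (x + P.toLoc v) (x + P.toLoc w) := by
    intro x hx hxw
    by_contra! hno
    obtain ⟨φ, h1, h2, h3⟩ := hI.locIdeal.exists_functional hxw
    have h4 := map_eq_of_forall_ne (φ ∘ₗ LinearMap.mulLeft k (mono k x) ∘ₗ locLinear k P) g w
      fun v hv hne => by
        change φ (mono k x * locMap k P (mono k v)) = 0
        rw [locMap_mono, ← mono_add]
        exact h3 _ (hno v hv hne)
    change φ (mono k x * locMap k P g) = g.coeff w • φ (mono k x * locMap k P (mono k w)) at h4
    rw [h1 _ (hann x hx), locMap_mono, ← mono_add, h2, smul_eq_mul, mul_one] at h4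
    exact hgw h4.symm
  have hnle : ∀ x : P.Loc, ¬ IsAddUnit x → ¬ LocLE I P (x + P.toLoc w) (P.toLoc w) := by
    rintro x hx ⟨u, hu⟩
    rw [add_right_comm] at hu
    have hxu : ¬ IsAddUnit (x + u) := fun h => hx (isAddUnit_of_add_isAddUnit_left h)
    -- With `z = x + u` and `z + w ~ w`, a partner satisfies `z + v ~ w`, so `v` precedes `w`.
    -- Minimality gives `w + y ~ v`, whence `v ~ w + y ~ z + w + y ~ z + v ~ w`, against
    -- distinctness of the classes.
    obtain ⟨v, hv, hne, hvw⟩ := hpartner (x + u) hxu fun h =>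
      hg1 w hw ((mono_mem_iff_of_inducedCon hu).1 h)
    have hvw' := (inducedCon _).trans hvw hu
    obtain ⟨y, hy⟩ := hmin v hv ⟨x + u, by rwa [add_comm]⟩
    refine hne (hg2 v hv w hw ((inducedCon _).trans ?_ hvw'))
    refine (inducedCon _).trans ((inducedCon _).symm hy) ?_
    refine (inducedCon _).trans (con_add_right ((inducedCon _).symm hu) y) ?_
    rw [add_assoc]
    exact con_add_left hy _
  obtain ⟨ρ, hρ, -⟩ := existsUnique_isCharacterAt hI (hg1 w hw) hnle
  refine ⟨w, ρ, ⟨hg1 w hw, fun hnil => ?_, fun p hp => ?_⟩, hρ, fun hmem => ?_, ?_⟩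
  · by_cases hwP : w ∈ P.carrier
    · have h1 := hnil.2 (toLocQuot (inducedCon I) P w)
      rw [toLocQuot_apply, ← AddCon.coe_add, mk_eq_mk_iff] at h1
      exact hnle _ (fun h => P.isAddUnit_toLoc_iff.1 h hwP) (LocLE.of_con h1)
    · exact not_isNil_of_isCancellative (isCancellative_of_isAddUnit
        (isAddUnit_mk _ (P.isAddUnit_toLoc_of_mem_face hwP))) hnil
  · have hpu : ¬ IsAddUnit (P.toLoc p) := fun h => P.isAddUnit_toLoc_iff.1 h hp
    by_cases hpw : mono k (P.toLoc p + P.toLoc w) ∈ locIdeal I P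
    -- Here `p + w` serves as the partner of `w`: it and its translate by `p` both have their
    -- monomials in `I_P`.
    · refine ⟨((P.toLoc p + P.toLoc w : P.Loc) : LocQuot (inducedCon I) P), fun h => ?_, ?_⟩
      · rw [toLocQuot_apply, mk_eq_mk_iff] at h
        exact hg1 w hw ((mono_mem_iff_of_inducedCon h).1 hpw)
      · rw [toLocQuot_apply, toLocQuot_apply, ← AddCon.coe_add, ← AddCon.coe_add, mk_eq_mk_iff]
        refine inducedCon_of_mono_mem ?_ hpw
        rw [add_comm]
        exact mono_add_mem hpw _
    · obtain ⟨v, hv, hne, hvw⟩ := hpartner _ hpu hpw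
      refine ⟨((P.toLoc v : P.Loc) : LocQuot (inducedCon I) P), fun h => ?_, ?_⟩
      · rw [toLocQuot_apply, mk_eq_mk_iff] at h
        exact hne (hg2 v hv w hw h)
      · rw [toLocQuot_apply, toLocQuot_apply, ← AddCon.coe_add, ← AddCon.coe_add, mk_eq_mk_iff]
        exact hvw
  · rw [component_eq, Ideal.mem_comap] at hmem
    have hgW := (locComponent I P w ρ).sub_mem hmem (locIdeal_le_locComponent hfg)
    rw [sub_sub_cancel] at hgW
    obtain ⟨φ, h1, h2, h3⟩ :=
      (isBinomial_locComponent (ρ := ρ) hI).exists_functional (mono_notMem_locComponent hI hρ)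
    -- The component joins to `w` only its stabilizer translates, which are already in its class
    -- modulo `I_P`; so no other term of `g` falls into that class.
    have h4 := map_eq_of_forall_ne (φ ∘ₗ locLinear k P) g w fun v hv hne => by
      rw [LinearMap.comp_apply, locLinear_apply, locMap_mono]
      refine h3 _ fun hc => hne (hg2 v hv w hw ?_)
      obtain ⟨h, hh, hvw⟩ :=
        exists_stabilizer_of_inducedCon_locComponent hI hρ hc (LocLE.refl _)
      exact (inducedCon _).trans hvw (mem_stabilizer_iff.1 hh)
    rw [LinearMap.comp_apply, LinearMap.comp_apply, locLinear_apply, locLinear_apply, h1 _ hgW,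
      locMap_mono, h2, smul_eq_mul, mul_one] at h4
    exact hgw h4.symm
  -- If no face translate of a term from `T` met the class of `w`, the functional at `w` would kill
  -- the face multiples of `T`. It kills the multiples by `P` because they lie in `I_P`, so it would
  -- kill `f` and with it the nonzero coefficient of `g` at `w`.
  · by_contra! hno
    obtain ⟨φ, h1, h2, h3⟩ := hI.locIdeal.exists_functional (hg1 w hw)
    have hker : f ∈ LinearMap.ker (φ ∘ₗ locLinear k P) := by
      have hsoc' := hsoc
      rw [hT] at hsoc'
      refine mem_of_mem_ideal_span _ (fun a e he => ?_) hsoc'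
      rw [LinearMap.mem_ker, LinearMap.comp_apply, locLinear_apply]
      by_cases ha : a ∈ P.carrier
      · have : e ∈ socleIdeal I P := hT ▸ Ideal.subset_span he
        exact h1 _ (this a ha)
      · have h4 := map_eq_zero_of_forall
          (φ ∘ₗ locLinear k P ∘ₗ LinearMap.mulLeft k (mono k a)) e fun τ hτ => by
            change φ (locMap k P (mono k a * mono k τ)) = 0
            rw [← mono_add, locMap_mono, add_comm, map_add]
            exact h3 _ (hno e he τ hτ a ha)
        exact h4
    rw [LinearMap.mem_ker, LinearMap.comp_apply, locLinear_apply] at hker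
    have h5 := h1 _ hfg
    rw [map_sub, hker, zero_sub, neg_eq_zero] at h5
    have h6 := map_eq_of_forall_ne (φ ∘ₗ locLinear k P) g w fun v hv hne => by
      rw [LinearMap.comp_apply, locLinear_apply, locMap_mono]
      exact h3 _ fun hc => hne (hg2 v hv w hw hc)
    rw [LinearMap.comp_apply, LinearMap.comp_apply, locLinear_apply, locLinear_apply, h5,
      locMap_mono, h2, smul_eq_mul, mul_one] at h6
    exact hgw h6.symm

/-- Every element outside of an ideal has a monomial multiple which is a nonzero socle element at
some monoid prime. -/
theorem exists_prime_socle [AddMonoid.FG Q] {f : AddMonoidAlgebra k Q} (hf : f ∉ I) :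
    ∃ (P : MonoidPrime Q) (x : Q), locMap k P (mono k x * f) ∉ locIdeal I P ∧
      mono k x * f ∈ socleIdeal I P := by
  have : IsNoetherianRing (AddMonoidAlgebra k Q) := Algebra.FiniteType.isNoetherianRing k _
  -- Only monomial multiples of `f` compete, so maximality makes the set of monomials in the
  -- annihilator prime, not the annihilator itself.
  let C : Set (Ideal (AddMonoidAlgebra k Q)) :=
    {A | ∃ x : Q, mono k x * f ∉ I ∧ A = I.colon {mono k x * f}}
  obtain ⟨A, ⟨x, hx, rfl⟩, hmax⟩ := set_has_maximal_iff_noetherian.2 this C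
    ⟨_, 0, by rwa [mono_zero, one_mul], rfl⟩
  have hmem : ∀ {q y : Q}, mono k q ∈ I.colon {mono k y * f} ↔ mono k q * (mono k y * f) ∈ I :=
    Submodule.mem_colon_singleton
  let P : MonoidPrime Q :=
    { carrier := {q | mono k q * (mono k x * f) ∈ I}
      zero_notMem := fun h => hx (by
        rw [Set.mem_ofPred_eq, mono_zero, one_mul] at h
        exact h)
      add_mem := fun p hp q => by
        rw [Set.mem_ofPred_eq, add_comm, mono_add, mul_assoc]
        exact I.mul_mem_left _ hp
      mem_or_mem := fun a b hab => by
        by_contra! h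
        obtain ⟨ha, hb⟩ := h
        refine hmax (I.colon {mono k (a + x) * f}) ⟨a + x, ?_, rfl⟩ ?_
        · rw [mono_add, mul_assoc]
          exact ha
        · refine lt_of_le_of_ne (fun e he => ?_) fun he => hb ?_
          · rw [Submodule.mem_colon_singleton, smul_eq_mul] at he ⊢
            rw [mono_add, mul_assoc, mul_left_comm]
            exact I.mul_mem_left _ he
          · have h1 : mono k b ∈ I.colon {mono k (a + x) * f} := by
              rw [hmem, ← mul_assoc, ← mono_add, add_left_comm, ← add_assoc, mono_add, mul_assoc]
              exact hab
            rw [← he] at h1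
            exact hmem.1 h1 }
  refine ⟨P, x, fun h => ?_, fun p hp => locMap_mem_locIdeal hp⟩
  obtain ⟨s, hs, h⟩ := locMap_mem_locIdeal_iff.1 h
  exact hs h

/-- A prime is determined by the generators of `Q` that it contains. -/
theorem MonoidPrime.finite [AddMonoid.FG Q] : Finite (MonoidPrime Q) := by
  obtain ⟨G, hG⟩ := AddMonoid.FG.fg_top (M := Q)
  refine Finite.of_injective
    (fun P : MonoidPrime Q => {g : G | (g : Q) ∈ P.carrier}) fun P P₂ h => ?_
  apply MonoidPrime.ext_carrier
  ext q
  have hq : q ∈ AddSubmonoid.closure (G : Set Q) := hG ▸ AddSubmonoid.mem_top q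
  induction hq using AddSubmonoid.closure_induction with
  | mem g hg => exact (Set.ext_iff.1 h ⟨g, hg⟩)
  | zero => exact ⟨fun h => (P.zero_notMem h).elim, fun h => (P₂.zero_notMem h).elim⟩
  | add a b _ _ ha hb =>
    have key : ∀ P : MonoidPrime Q, a + b ∈ P.carrier ↔ a ∈ P.carrier ∨ b ∈ P.carrier := fun P =>
      ⟨P.mem_or_mem a b, fun h => h.elim (fun h => P.add_mem a h b)
        fun h => add_comm a b ▸ P.add_mem b h a⟩
    exact (key P).trans ((or_congr ha hb).trans (key P₂).symm)

/-- Finitely many coprincipal components of a binomial ideal have the ideal as intersection. -/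
theorem exists_finite_components [AddMonoid.FG Q] (hI : IsBinomial I) :
    ∃ 𝒥 : Set (Ideal (AddMonoidAlgebra k Q)), 𝒥.Finite ∧
      (∀ J ∈ 𝒥, ∃ P : MonoidPrime Q, IsCoprincipalComponent I P J) ∧ I = sInf 𝒥 := by
  have hN : IsNoetherianRing (AddMonoidAlgebra k Q) := Algebra.FiniteType.isNoetherianRing k _
  have := MonoidPrime.finite (Q := Q)
  have hfg : ∀ P : MonoidPrime Q, ∃ T : Finset (AddMonoidAlgebra k Q),
      socleIdeal I P = Ideal.span (T : Set (AddMonoidAlgebra k Q)) := by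
    intro P
    obtain ⟨T, hT⟩ := (isNoetherianRing_iff_ideal_fg _).1 hN (socleIdeal I P)
    exact ⟨T, hT.symm⟩
  choose T hT using hfg
  -- The components cogenerated by translates of `τ` by the face. Two such cogenerators differ by a
  -- unit modulo `I_P`, so there is at most one component for each `τ`.
  let C : MonoidPrime Q → Q → Set (Ideal (AddMonoidAlgebra k Q)) := fun P τ =>
    {J | ∃ (w : Q) (ρ : Multiplicative (stabilizer I P w) →* kˣ), IsWitness I P w ∧
      IsCharacterAt I P w ρ ∧ J = component I P w ρ ∧ ∃ s ∈ P.face,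
        inducedCon (locIdeal I P) (P.toLoc τ + P.toLoc s) (P.toLoc w)}
  have hC : ∀ P τ, (C P τ).Subsingleton := by
    rintro P τ _ ⟨w, ρ, -, hρ, rfl, s, hs, hw⟩ _ ⟨w', ρ', -, hρ', rfl, s', hs', hw'⟩
    obtain ⟨v, hv⟩ := (P.isAddUnit_toLoc_of_mem_face hs).exists_neg
    have hv' : IsAddUnit v := ⟨⟨v, _, by rw [add_comm]; exact hv, hv⟩, rfl⟩
    refine component_eq_of_con hρ hρ' (u := v + P.toLoc s')
      (hv'.add (P.isAddUnit_toLoc_of_mem_face hs')) ((inducedCon _).trans ?_ hw')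
    rw [← add_assoc]
    refine con_add_right ?_ _
    have := con_add_right ((inducedCon _).symm hw) v
    rwa [add_assoc, hv, add_zero] at this
  refine ⟨⋃ P, ⋃ e ∈ T P, ⋃ τ ∈ e.coeff.support, C P τ, ?_, ?_, ?_⟩
  · exact Set.finite_iUnion fun P => (T P).finite_toSet.biUnion fun e _ =>
      (e.coeff.support).finite_toSet.biUnion fun τ _ => (hC P τ).finite
  · intro J hJ
    simp only [Set.mem_iUnion] at hJ
    obtain ⟨P, e, -, τ, -, w, ρ, hw, hρ, rfl, -⟩ := hJ
    exact ⟨P, w, ρ, hw, hρ, rfl⟩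
  · refine le_antisymm (le_sInf fun J hJ => ?_) fun f hf => ?_
    · simp only [Set.mem_iUnion] at hJ
      obtain ⟨P, e, -, τ, -, w, ρ, -, -, rfl, -⟩ := hJ
      exact le_component
    · by_contra hfI
      obtain ⟨P, x, h1, h2⟩ := exists_prime_socle hfI
      obtain ⟨w, ρ, hw, hρ, hmem, e, he, τ, hτ, s, hs, hc⟩ :=
        exists_component_notMem hI h1 h2 (hT P)
      refine hmem (Ideal.mul_mem_left _ _ (Ideal.mem_sInf.1 hf ?_))
      simp only [Set.mem_iUnion]
      exact ⟨P, e, he, τ, hτ, w, ρ, hw, hρ, rfl, s, hs, hc⟩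

end Intersection

end BinomialDecomposition

/-! ### The theorem -/

open BinomialDecomposition in
theorem theoremt {k : Type*} [Field k] {Q : Type*} [AddCommMonoid Q] [AddMonoid.FG Q]
    (I : Ideal (AddMonoidAlgebra k Q)) (hI : IsBinomial I) :
    -- every witness strictly below its translates by `P` has exactly one character
    (∀ (P : MonoidPrime Q) (w : Q), IsWitness I P w →
      (∀ p ∈ P.carrier, p + w ∉ orderIdeal (inducedCon I) P w) →
        ∃! ρ : Multiplicative (stabilizer I P w) →* kˣ, IsCharacterAt I P w ρ) ∧
    -- the components cogenerated by witnesses are coprincipal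
    (∀ (P : MonoidPrime Q) (J : Ideal (AddMonoidAlgebra k Q)), IsCoprincipalComponent I P J →
      IsCoprincipal J ∧ IsMesoprimaryFor J P) ∧
    -- their intersection is `I`
    I = sInf {J | ∃ P : MonoidPrime Q, IsCoprincipalComponent I P J} ∧
    -- finitely many of them form a combinatorial mesoprimary decomposition
    ∃ 𝒥 : Set (Ideal (AddMonoidAlgebra k Q)),
      (∀ J ∈ 𝒥, ∃ P : MonoidPrime Q, IsCoprincipalComponent I P J) ∧
        IsCombinatorialDecomposition I 𝒥 := by
  obtain ⟨𝒥, hfin, hcomp, hinf⟩ := exists_finite_components hI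
  refine ⟨fun P w hw h => ?_, ?_, ?_, 𝒥, hcomp, ⟨hfin, hinf, fun J hJ => ?_, ?_⟩, ?_⟩
  · refine existsUnique_isCharacterAt hI hw.1 (not_locLE_of_forall_mem fun p hp hle => ?_)
    exact h p hp (mem_orderIdeal_iff.2 (by rwa [map_add]))
  · rintro P _ ⟨w, ρ, -, hρ, rfl⟩
    exact ⟨isCoprincipal_component hI hρ, isMesoprimaryFor_component hI hρ⟩
  · apply le_antisymm
    · refine le_sInf ?_
      rintro _ ⟨P, w, ρ, -, -, rfl⟩
      exact le_component
    · conv_rhs => rw [hinf]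
      exact sInf_le_sInf hcomp
  · obtain ⟨P, w, ρ, -, hρ, rfl⟩ := hcomp J hJ
    have := isMesoprimaryFor_component hI hρ
    exact ⟨this.1, this.2.1⟩
  · intro J hJ P' hP' q hq
    obtain ⟨P, w, ρ, -, hρ, rfl⟩ := hcomp J hJ
    -- The associated prime is the nilpotent ideal of the congruence, so `P'` is the prime of the
    -- component.
    obtain rfl := hP'.2.unique (isMesoprimaryConFor_component hI hρ)
    exact mesoprimeAt_eq_of_inMonomialSocle hI hρ hq
  · intro J hJ P' hP' q hq
    obtain ⟨P, w, ρ, hw, hρ, rfl⟩ := hcomp J hJ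
    obtain rfl := hP'.2.unique (isMesoprimaryConFor_component hI hρ)
    obtain ⟨u, hu, hc⟩ := exists_unit_of_inMonomialSocle hI hρ hq
    exact hw.of_con hu hc
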